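/- Let $n\ge 3$. For $\tau\neq 0$ with $|\tau|$ small, there is a unique pair of $C^2$ functions $r_\tau>0$, $k_\tau$ on $\mathbb R$ such that the rotationally invariant immersion $Y_\tau(t,\Theta)=(k_\tau(t),r_\tau(t)\Theta)$ of $\mathbb R\times\mathbb S^{n-1}$ into $\mathbb R^{n+1}$ is conformal with $(k_\tau')^2+(r_\tau')^2=r_\tau^2$, has mean curvature $1$ with respect to the unit normal $\bigl(r_\tau'/r_\tau,\,-(k_\tau'/r_\tau)\Theta\bigr)$ (normalized so that the unit sphere with inward normal has mean curvature $1$), has force parameter $\tau$, i.e. $r_\tau^{n-2}k_\tau'-r_\tau^{n}=\tau$, and satisfies $k_\tau(0)=0$ and $r_\tau(0)=\max r_\tau$ (the Delaunay immersion of parameter $\tau$). The function $r_\tau$ has a least positive period $2p_\tau$ (the domain period). Define the translational half-period $P_\tau$ by $2P_\tau=k_\tau(2p_\tau)-2$. Then $\tau\mapsto P_\tau$ is differentiable at every $\tau\ne0$ with $|\tau|$ small, the integral $$T_n:=\int_1^\infty\frac{dr}{\sqrt{r^{2n-2}-1}}$$ converges, and $$\lim_{\tau\to0^+}|\tau|^{\frac1{1-n}}P_\tau=T_n,\qquad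 \lim_{\tau\to0^-}|\tau|^{\frac1{1-n}}P_\tau=-T_n,\qquad \lim_{\tau\to0}|\tau|^{\frac{n-2}{n-1}}\frac{dP_\tau}{d\tau}=\frac{T_n}{n-1}.$$ -/

import Mathlib

open Filter Topology MeasureTheory Set

noncomputable section

/-- Mean curvature at parameter `t` of the hypersurface of revolution
`(t, Θ) ↦ (k t, r t • Θ)`, `Θ ∈ 𝕊ⁿ⁻¹`, in `ℝⁿ⁺¹`: the normalized sum of the `n - 1` equal
rotational principal curvatures and the principal curvature of the generating curve, taken
with respect to the unit normal `(r', -k' Θ) / √(k'² + r'²)` (the round unit sphere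
`k = tanh`, `r = sech` has mean curvature `1`). -/
def revolutionMeanCurvature (n : ℕ) (r k : ℝ → ℝ) (t : ℝ) : ℝ :=
  (((n : ℝ) - 1) * (deriv k t / (r t * √((deriv k t) ^ 2 + (deriv r t) ^ 2)))
    + (deriv (deriv k) t * deriv r t - deriv k t * deriv (deriv r) t)
        / (√((deriv k t) ^ 2 + (deriv r t) ^ 2)) ^ 3) / (n : ℝ)

/-- `(t, Θ) ↦ (k t, r t • Θ)` is the Delaunay immersion `ℝ × 𝕊ⁿ⁻¹ → ℝⁿ⁺¹` of force
parameter `τ`: rotationally invariant about the first axis, conformal to the standard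
cylinder, with mean curvature `1`, normalized so that `k 0 = 0` and the radius is maximal
at `t = 0`. -/
structure IsDelaunayProfile (n : ℕ) (τ : ℝ) (r k : ℝ → ℝ) : Prop where
  contDiff_r : ContDiff ℝ 2 r
  contDiff_k : ContDiff ℝ 2 k
  r_pos : ∀ t, 0 < r t
  conformal : ∀ t, (deriv r t) ^ 2 + (deriv k t) ^ 2 = (r t) ^ 2
  force : ∀ t, (r t) ^ (n - 2) * deriv k t - (r t) ^ n = τ
  meanCurvature : ∀ t, revolutionMeanCurvature n r k t = 1
  r_max : ∀ t, r t ≤ r 0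
  k_zero : k 0 = 0

/-- The pair `(r_τ, k_τ)`, as the (unique, for small `τ ≠ 0`) Delaunay profile. -/
def delaunayProfile (n : ℕ) (τ : ℝ) : (ℝ → ℝ) × (ℝ → ℝ) :=
  Classical.epsilon fun p : (ℝ → ℝ) × (ℝ → ℝ) => IsDelaunayProfile n τ p.1 p.2

/-- The radius function `r_τ`. -/
def delaunayRadius (n : ℕ) (τ : ℝ) : ℝ → ℝ := (delaunayProfile n τ).1

/-- The axial function `k_τ`. -/
def delaunayAxis (n : ℕ) (τ : ℝ) : ℝ → ℝ := (delaunayProfile n τ).2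

/-- The domain period: the least positive period of `r_τ` (equivalently of
`w = log (r_τ / |τ| ^ (1 / n))`). -/
def delaunayDomainPeriod (n : ℕ) (τ : ℝ) : ℝ :=
  sInf {T : ℝ | 0 < T ∧ Function.Periodic (delaunayRadius n τ) T}

/-- The translational half-period `P_τ`, given by
`2 P_τ = k_τ (domain period) - 2`. -/
def delaunayHalfPeriod (n : ℕ) (τ : ℝ) : ℝ :=
  (delaunayAxis n τ (delaunayDomainPeriod n τ) - 2) / 2

/-- The catenoid constant `T_n`. -/
def catenoidConst (n : ℕ) : ℝ :=
  ∫ r in Ioi (1 : ℝ), 1 / √(r ^ (2 * n - 2) - 1)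

end

/-!
For a profile of force parameter `τ`, conformality and the force balance give
`k' = (r ^ n + τ) / r ^ (n-2)` and `r'² = r² - k'²`, that is
`r ^ (2n-4) r'² = radialPotential n τ r = r ^ (2n-2) - (r ^ n + τ) ^ 2`. Mean curvature `1` adds the
derivative of this relation, `r'' = radialForce n τ r`, also where `r' = 0`. For small `τ ≠ 0` the
potential is non-negative exactly between two simple zeros, the neck radius `m` and the bulge
radius `M`.

*Existence and uniqueness.* Writing `r = (m+M)/2 + (M-m)/2 cos θ` absorbs both zeros and leaves an
angle equation `θ' = ω(θ)` with `ω` smooth, positive and `2π`-periodic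
(`exists_angle_solution`, `IsRadiusRange.exists_profile`); one turn of `θ` is the least period.
Uniqueness is that of the second-order equation with `r(0) = M`, `r'(0) = 0`: starting at the
neck radius, the profile would be a cylinder of the wrong radius (`IsDelaunayProfile.unique`).
Over one period, `k` grows by `2 ∫ₘᴹ (r ^ n + τ) / √(radialPotential n τ r) dr`.

*The half-period.* Put `α = 1/(n-1)`, `τ = σ e` with `σ = ±1` and `e > 0`, and `y = r ^ (n-1)`. The
powers `u`, `v` of the two radii solve `u - σ u^(1+α) = e` and `v - v^(1+α) = σ e`, hence are
differentiable in `e > 0`. With `y = (1-x) u + x v` the integral above is over the fixed interval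
`(0, 1)`. The choice of `y`, rather than `r`, as the coordinate makes the neck move with `e` by a
translation to leading order, so that the effect of varying `e` is confined to the neck. Concavity
of `y - y^(1+α)` bounds the potential below by a multiple of `y x (1-x)` uniformly in `e`
(`IsRoots.discr_lower`), and the `e`-derivative of the numerator carries a factor `x (1-x)`
(`IsMovingRoots.abs_transportDefect_le`). Hence the derivative of the integrand is at most a
constant times `y^(α-3/2) (x(1-x))^(-1/2)`, which justifies differentiation under the integral sign
and, after the substitution `x = e ξ`, passage to the limit by dominated convergence
(`IsRootPair.tendsto_integral_axialDensityDeriv`). The limit integrand differs by an exact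
derivative from `α` times the catenoid integrand (`integral_neckDensity`). This is the limit of
`dP/dτ`; since `P → 0` (`IsRootPair.tendsto_axialIntegral`), the limits of `P` follow by
l'Hôpital's rule.
-/

/-! ### Autonomous equations on the circle -/

/-- The angle equation `θ' = ω(θ)` with a positive `2π`-periodic right-hand side is solved on all
of `ℝ` by inverting the travel time `∫ dx / ω(x)`; the solution advances by one full turn in time
`∫₀^{2π} dx / ω(x)`. -/
theorem exists_angle_solution {ω : ℝ → ℝ} (hc : Continuous ω) (hpos : ∀ x, 0 < ω x)
    (hper : Function.Periodic ω (2 * Real.pi)) :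
    ∃ (θ : ℝ → ℝ) (L : ℝ), 0 < L ∧ θ 0 = 0 ∧ (∀ t, HasDerivAt θ (ω (θ t)) t) ∧ StrictMono θ ∧
      ∀ t, θ (t + L) = θ t + 2 * Real.pi := by
  have hic : Continuous fun x => (ω x)⁻¹ := hc.inv₀ fun x => (hpos x).ne'
  have hii : ∀ a b, IntervalIntegrable (fun x => (ω x)⁻¹) volume a b :=
    fun a b => hic.intervalIntegrable a b
  set S : ℝ → ℝ := fun x => ∫ s in (0 : ℝ)..x, (ω s)⁻¹ with hS
  have hSd : ∀ x, HasDerivAt S (ω x)⁻¹ x := fun x =>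
    intervalIntegral.integral_hasDerivAt_right (hii 0 x)
      hic.aestronglyMeasurable.stronglyMeasurableAtFilter hic.continuousAt
  have hSmono : StrictMono S := strictMono_of_deriv_pos fun x => by
    rw [(hSd x).deriv]; exact inv_pos.2 (hpos x)
  have hScont : Continuous S := continuous_iff_continuousAt.2 fun x => (hSd x).continuousAt
  have hS0 : S 0 = 0 := by simp [hS]
  have hSper : ∀ x, S (x + 2 * Real.pi) = S x + S (2 * Real.pi) := by
    intro x
    have h1 : (fun x => (ω x)⁻¹).Periodic (2 * Real.pi) := fun x => by simp [hper x]
    have h2 := h1.intervalIntegral_add_eq x 0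
    have h3 := intervalIntegral.integral_add_adjacent_intervals (hii 0 x) (hii x (x + 2 * Real.pi))
    simp only [zero_add] at h2
    simp only [hS]
    rw [← h3, h2]
  have hL : 0 < S (2 * Real.pi) := by
    rw [← hS0]; exact hSmono Real.two_pi_pos
  -- Additivity over full turns makes `S` unbounded in both directions.
  have hSz : ∀ k : ℕ, S (k * (2 * Real.pi)) = k * S (2 * Real.pi) := by
    intro k
    induction k with
    | zero => simp [hS0]
    | succ k ih =>
      have := hSper (k * (2 * Real.pi))
      rw [ih] at this
      push_cast
      rw [add_mul, one_mul, this]; ring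
  have hSz' : ∀ k : ℕ, S (-(k * (2 * Real.pi))) = -(k * S (2 * Real.pi)) := by
    intro k
    induction k with
    | zero => simp [hS0]
    | succ k ih =>
      have := hSper (-((k + 1 : ℝ) * (2 * Real.pi)))
      rw [show -((k + 1 : ℝ) * (2 * Real.pi)) + 2 * Real.pi = -(k * (2 * Real.pi)) by ring, ih]
        at this
      push_cast
      linarith
  have hsurj : Function.Surjective S := by
    intro y
    obtain ⟨k, hk⟩ := exists_nat_gt (|y| / S (2 * Real.pi))
    rw [div_lt_iff₀ hL] at hk
    have h1 := abs_lt.1 hk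
    have : y ∈ Icc (S (-(k * (2 * Real.pi)))) (S (k * (2 * Real.pi))) := by
      rw [hSz, hSz']; exact ⟨h1.1.le, h1.2.le⟩
    obtain ⟨x, -, hx⟩ := intermediate_value_Icc (by
      have : 0 ≤ k * (2 * Real.pi) := by positivity
      linarith) hScont.continuousOn this
    exact ⟨x, hx⟩
  set e := hSmono.orderIsoOfSurjective S hsurj with he
  have hSe : ∀ t, S (e.symm t) = t := fun t =>
    hSmono.orderIsoOfSurjective_self_symm_apply S hsurj t
  have hinj := hSmono.injective
  refine ⟨e.symm, S (2 * Real.pi), hL, ?_, ?_, e.symm.strictMono, ?_⟩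
  · exact hinj (by rw [hSe, hS0])
  · intro t
    have := HasDerivAt.of_local_left_inverse (f := S) (g := e.symm) (a := t)
      e.symm.continuous.continuousAt (hSd _) (inv_pos.2 (hpos _)).ne'
      (Eventually.of_forall hSe)
    simpa using this
  · intro t
    apply hinj
    rw [hSe, hSper, hSe]

/-! ### The radius equation -/

/-- `k'` as a function of the radius, read off from the force balance `r ^ (n-2) k' - r ^ n = τ`. -/
noncomputable def axisSpeed (n : ℕ) (τ r : ℝ) : ℝ := (r ^ n + τ) / r ^ (n - 2)

/-- `r''` as a function of the radius: half the derivative of `r ^ 2 - axisSpeed n τ r ^ 2`. -/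
noncomputable def radialForce (n : ℕ) (τ r : ℝ) : ℝ :=
  r - axisSpeed n τ r * (n * r - ((n : ℝ) - 2) * axisSpeed n τ r / r)

/-- `r ^ (2n-4) r'²` as a function of the radius; its zeros are the neck and bulge radii. -/
def radialPotential (n : ℕ) (τ r : ℝ) : ℝ := r ^ (2 * n - 2) - (r ^ n + τ) ^ 2

theorem hasDerivAt_axisSpeed {n : ℕ} (hn : 2 ≤ n) (τ : ℝ) {r : ℝ} (hr : 0 < r) :
    HasDerivAt (axisSpeed n τ) (n * r - ((n : ℝ) - 2) * axisSpeed n τ r / r) r := by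
  obtain ⟨j, rfl⟩ := Nat.exists_eq_add_of_le' hn
  have h := ((hasDerivAt_pow (j + 2) r).add_const τ).div (hasDerivAt_pow j r) (by positivity)
  have e : axisSpeed (j + 2) τ = fun r => (r ^ (j + 2) + τ) / r ^ j := by
    funext r; simp [axisSpeed]
  have e1 : axisSpeed (j + 2) τ r = (r ^ (j + 2) + τ) / r ^ j := by rw [e]
  rw [e1, e]
  refine h.congr_deriv ?_
  rcases j with _ | j
  · simp
  · push_cast
    field_simp
    ring

theorem radialPotential_eq {n : ℕ} (hn : 2 ≤ n) (τ : ℝ) {r : ℝ} (hr : 0 < r) :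
    radialPotential n τ r = r ^ (2 * (n - 2)) * (r ^ 2 - axisSpeed n τ r ^ 2) := by
  obtain ⟨j, rfl⟩ := Nat.exists_eq_add_of_le' hn
  simp only [radialPotential, axisSpeed, Nat.add_sub_cancel,
    show 2 * (j + 2) - 2 = 2 * j + 2 by omega]
  field_simp
  ring

theorem contDiffAt_axisSpeed (n : ℕ) (τ : ℝ) {r : ℝ} (hr : 0 < r) {i : WithTop ℕ∞} :
    ContDiffAt ℝ i (axisSpeed n τ) r := by
  unfold axisSpeed
  exact ((contDiffAt_id.pow n).add contDiffAt_const).div (contDiffAt_id.pow (n - 2))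
    (pow_ne_zero _ hr.ne')

theorem contDiffAt_radialForce (n : ℕ) (τ : ℝ) {r : ℝ} (hr : 0 < r) {i : WithTop ℕ∞} :
    ContDiffAt ℝ i (radialForce n τ) r := by
  have h := contDiffAt_axisSpeed n τ hr (i := i)
  unfold radialForce
  exact contDiffAt_id.sub (h.mul ((contDiffAt_const.mul contDiffAt_id).sub
    ((contDiffAt_const.mul h).div contDiffAt_id (by simpa using hr.ne'))))

/-- For a conformal profile satisfying the force balance, mean curvature `1` is the second-order
equation `r'' = radialForce n τ r`, except where `k' = 0`. -/
theorem revolutionMeanCurvature_eq_one_iff {n : ℕ} (hn : 2 ≤ n) {τ : ℝ} {r k : ℝ → ℝ}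
    (hr : Differentiable ℝ r) (hpos : ∀ t, 0 < r t) (hk : deriv k = fun t => axisSpeed n τ (r t))
    (hconf : ∀ t, deriv r t ^ 2 + deriv k t ^ 2 = r t ^ 2) (t : ℝ) :
    revolutionMeanCurvature n r k t = 1 ↔
      axisSpeed n τ (r t) * (radialForce n τ (r t) - deriv (deriv r) t) = 0 := by
  have h2 : deriv (deriv k) t =
      (n * r t - ((n : ℝ) - 2) * axisSpeed n τ (r t) / r t) * deriv r t := by
    rw [hk]
    exact ((hasDerivAt_axisSpeed hn τ (hpos t)).comp t (hr t).hasDerivAt).deriv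
  have hc := hconf t
  have hs : √(deriv k t ^ 2 + deriv r t ^ 2) = r t := by
    rw [add_comm, hc, Real.sqrt_sq (hpos t).le]
  have hn0 : (n : ℝ) ≠ 0 := by positivity
  have hk' : deriv k t = axisSpeed n τ (r t) := by rw [hk]
  unfold revolutionMeanCurvature
  rw [hs, h2, hk', div_eq_one_iff_eq hn0]
  rw [hk'] at hc
  unfold radialForce
  generalize axisSpeed n τ (r t) = s at *
  generalize deriv (deriv r) t = a at *
  generalize deriv r t = b at *
  have hp := hpos t
  generalize r t = x at *
  have hb : b ^ 2 = x ^ 2 - s ^ 2 := by linarith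
  have key : (((n : ℝ) - 1) * (s / (x * x)) + ((n * x - (n - 2) * s / x) * b * b - s * a) / x ^ 3)
      - n = s * (x - s * (n * x - (n - 2) * s / x) - a) / x ^ 3 := by
    rw [mul_assoc _ b b, ← sq b, hb]
    field_simp
    ring
  rw [← sub_eq_zero, key, div_eq_zero_iff]
  have : x ^ 3 ≠ 0 := by positivity
  simp [this]

/-- Differentiating `r'² = r² - k'²`. -/
theorem deriv_mul_deriv_deriv_sub_radialForce {n : ℕ} (hn : 2 ≤ n) {τ : ℝ} {r : ℝ → ℝ}
    (hr : ContDiff ℝ 2 r) (hpos : ∀ t, 0 < r t)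
    (hconf : ∀ t, deriv r t ^ 2 + axisSpeed n τ (r t) ^ 2 = r t ^ 2) (t : ℝ) :
    deriv r t * (deriv (deriv r) t - radialForce n τ (r t)) = 0 := by
  have hr1 : Differentiable ℝ r := hr.differentiable (by norm_num)
  have hr2 : Differentiable ℝ (deriv r) :=
    ((contDiff_succ_iff_deriv (n := 1)).1 hr).2.2.differentiable (by norm_num)
  have h1 := ((hr2 t).hasDerivAt.pow 2).add
    (((hasDerivAt_axisSpeed hn τ (hpos t)).comp t (hr1 t).hasDerivAt).pow 2)
  have h2 := (hr1 t).hasDerivAt.pow 2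
  have e : (deriv r ^ 2 + (axisSpeed n τ ∘ r) ^ 2) = r ^ 2 := by
    funext s; simpa using hconf s
  rw [e] at h1
  have h3 := h1.unique h2
  simp only [Function.comp] at h3
  unfold radialForce
  norm_num at h3
  linear_combination h3 / 2

theorem IsDelaunayProfile.deriv_axis {n : ℕ} {τ : ℝ} {r k : ℝ → ℝ}
    (h : IsDelaunayProfile n τ r k) : deriv k = fun t => axisSpeed n τ (r t) := by
  funext t
  have := h.force t
  have h0 : (r t) ^ (n - 2) ≠ 0 := (pow_pos (h.r_pos t) _).ne'
  rw [axisSpeed, eq_div_iff h0]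
  linarith

theorem IsDelaunayProfile.deriv_deriv_radius {n : ℕ} (hn : 2 ≤ n) {τ : ℝ} {r k : ℝ → ℝ}
    (h : IsDelaunayProfile n τ r k) (t : ℝ) : deriv (deriv r) t = radialForce n τ (r t) := by
  have hk := h.deriv_axis
  have hc := h.conformal
  have h1 := (revolutionMeanCurvature_eq_one_iff hn (h.contDiff_r.differentiable (by norm_num))
    h.r_pos hk hc t).1 (h.meanCurvature t)
  rw [hk] at hc
  have h2 := deriv_mul_deriv_deriv_sub_radialForce hn h.contDiff_r h.r_pos hc t
  rcases mul_eq_zero.1 h1 with h3 | h3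
  · rcases mul_eq_zero.1 h2 with h4 | h4
    · have := hc t
      have hp := h.r_pos t
      simp only [h3, h4] at this
      nlinarith
    · linarith
  · linarith

/-- The interval `[m, M]` is the range of radii allowed by `r'² ≥ 0`: both ends are simple zeros of
the radial potential, quantified by the quadratic lower bound. -/
structure IsRadiusRange (n : ℕ) (τ m M : ℝ) : Prop where
  pos : 0 < m
  lt : m < M
  neck : radialPotential n τ m = 0
  bulge : radialPotential n τ M = 0
  lower : ∃ κ > 0, ∀ r ∈ Icc m M, κ * ((r - m) * (M - r)) ≤ radialPotential n τ r
  mem : ∀ r, 0 < r → 0 ≤ radialPotential n τ r → r ∈ Icc m M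
  neck_lt : m < 1 / 2

theorem IsDelaunayProfile.radius_mem {n : ℕ} (hn : 2 ≤ n) {τ m M : ℝ} {r k : ℝ → ℝ}
    (h : IsDelaunayProfile n τ r k) (hR : IsRadiusRange n τ m M) (t : ℝ) : r t ∈ Icc m M := by
  apply hR.mem _ (h.r_pos t)
  rw [radialPotential_eq hn τ (h.r_pos t)]
  have hc := h.conformal t
  rw [h.deriv_axis] at hc
  have : (r t) ^ 2 - axisSpeed n τ (r t) ^ 2 = (deriv r t) ^ 2 := by linarith
  rw [this]
  have := h.r_pos t
  positivity

theorem IsDelaunayProfile.deriv_radius_zero {n : ℕ} {τ : ℝ} {r k : ℝ → ℝ}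
    (h : IsDelaunayProfile n τ r k) : deriv r 0 = 0 :=
  IsLocalMax.deriv_eq_zero (Eventually.of_forall h.r_max)

/-- The maximal radius is the bulge radius: were it the neck radius, the profile would be a
cylinder, whose radius has to be `(n-1)/n`. -/
theorem IsDelaunayProfile.radius_zero {n : ℕ} (hn : 2 ≤ n) {τ m M : ℝ} {r k : ℝ → ℝ}
    (h : IsDelaunayProfile n τ r k) (hR : IsRadiusRange n τ m M) : r 0 = M := by
  have hmem := h.radius_mem hn hR
  have h0 : radialPotential n τ (r 0) = 0 := by
    rw [radialPotential_eq hn τ (h.r_pos 0)]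
    have hc := h.conformal 0
    rw [h.deriv_axis, h.deriv_radius_zero] at hc
    simp only at hc
    rw [← hc]; ring
  obtain ⟨κ, hκ, hlow⟩ := hR.lower
  have h1 := hlow _ (hmem 0)
  rw [h0] at h1
  have h2 : (r 0 - m) * (M - r 0) ≤ 0 := by
    by_contra hcon
    push Not at hcon
    have := mul_pos hκ hcon
    linarith
  have hm := (hmem 0).1
  have hM := (hmem 0).2
  rcases hm.eq_or_lt with h3 | h3
  · exfalso
    have hconst : r = fun _ => m := by
      funext t
      exact le_antisymm ((h.r_max t).trans h3.symm.le) (hmem t).1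
    have hkd := h.deriv_axis
    have hc := h.conformal 0
    have hH := h.meanCurvature 0
    have hm0 := hR.pos
    have e1 : deriv r 0 = 0 := h.deriv_radius_zero
    have e2 : deriv (deriv k) 0 = 0 := by rw [hkd, hconst]; simp
    have e3 : deriv (deriv r) 0 = 0 := by rw [hconst]; simp
    have e0 : r 0 = m := h3.symm
    rw [e1, e0] at hc
    unfold revolutionMeanCurvature at hH
    rw [e2, e1, e3, e0] at hH
    have hs : √(deriv k 0 ^ 2 + 0 ^ 2) = m := by
      rw [add_comm, hc, Real.sqrt_sq hm0.le]
    rw [hs] at hH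
    have hle : deriv k 0 ≤ m := by nlinarith
    have hn0 : (0 : ℝ) < n := by positivity
    have hn2 : (2 : ℝ) ≤ n := by exact_mod_cast hn
    rw [div_eq_iff hn0.ne'] at hH
    field_simp at hH
    have := hR.neck_lt
    norm_num at hH
    have h4 : ((n : ℝ) - 1) * deriv k 0 = n * m ^ 2 :=
      mul_right_cancel₀ hm0.ne' (by linear_combination hH)
    have h5 : (deriv k 0 - m) * (deriv k 0 + m) = 0 := by linear_combination hc
    rcases mul_eq_zero.1 h5 with h6 | h6
    · have h7 : (n : ℝ) - 1 = n * m :=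
        mul_right_cancel₀ hm0.ne' (by rw [← sub_eq_zero.1 h6] at h4 ⊢; linear_combination h4)
      nlinarith
    · have h7 : deriv k 0 = -m := by linarith
      rw [h7] at h4
      have : 0 < n * m ^ 2 := by positivity
      nlinarith
  · nlinarith

/-- Uniqueness of the Delaunay profile, by uniqueness for `r'' = radialForce n τ r` with
`r(0) = M`, `r'(0) = 0`. -/
theorem IsDelaunayProfile.unique {n : ℕ} (hn : 2 ≤ n) {τ m M : ℝ} {r k r' k' : ℝ → ℝ}
    (h : IsDelaunayProfile n τ r k) (h' : IsDelaunayProfile n τ r' k')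
    (hR : IsRadiusRange n τ m M) : r = r' ∧ k = k' := by
  have hlip : ∃ K, LipschitzOnWith K (radialForce n τ) (Icc m M) := by
    apply ContDiffOn.exists_lipschitzOnWith (n := 1) _ one_ne_zero (convex_Icc m M) isCompact_Icc
    intro x hx
    exact (contDiffAt_radialForce n τ (hR.pos.trans_le hx.1)).contDiffWithinAt
  obtain ⟨K, hK⟩ := hlip
  let v : ℝ → ℝ × ℝ → ℝ × ℝ := fun _ x => (x.2, radialForce n τ x.1)
  let s : ℝ → Set (ℝ × ℝ) := fun _ => Icc m M ×ˢ univ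
  have hv : ∀ t, LipschitzOnWith (max 1 K) (v t) (s t) := fun t => by
    have h1 : LipschitzOnWith 1 (fun x : ℝ × ℝ => x.2) (s t) :=
      LipschitzWith.prod_snd.lipschitzOnWith
    have h2 : LipschitzOnWith (K * 1) (fun x : ℝ × ℝ => radialForce n τ x.1) (s t) :=
      hK.comp LipschitzWith.prod_fst.lipschitzOnWith fun x hx => hx.1
    simpa using h1.prodMk h2
  have sol : ∀ {r k : ℝ → ℝ}, IsDelaunayProfile n τ r k → ∀ t,
      HasDerivAt (fun t => (r t, deriv r t)) (v t (r t, deriv r t)) t ∧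
        (r t, deriv r t) ∈ s t := by
    intro r k h t
    have hr1 : Differentiable ℝ r := h.contDiff_r.differentiable (by norm_num)
    have hr2 : Differentiable ℝ (deriv r) :=
      ((contDiff_succ_iff_deriv (n := 1)).1 h.contDiff_r).2.2.differentiable (by norm_num)
    refine ⟨?_, h.radius_mem hn hR t, trivial⟩
    have := (hr2 t).hasDerivAt
    rw [h.deriv_deriv_radius hn] at this
    exact (hr1 t).hasDerivAt.prodMk this
  have heq := ODE_solution_unique_univ (t₀ := 0) hv (sol h) (sol h')
    (by rw [h.radius_zero hn hR, h'.radius_zero hn hR, h.deriv_radius_zero, h'.deriv_radius_zero])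
  have hrr : r = r' := by
    funext t
    exact congrArg Prod.fst (congrFun heq t)
  refine ⟨hrr, ?_⟩
  apply eq_of_fderiv_eq (𝕜 := ℝ) (h.contDiff_k.differentiable (by norm_num))
    (h'.contDiff_k.differentiable (by norm_num)) _ 0 (by rw [h.k_zero, h'.k_zero])
  intro t
  ext
  simp only [fderiv_eq_smul_deriv]
  rw [h.deriv_axis, h'.deriv_axis, hrr]

/-! ### Construction of the profile -/

theorem IsRadiusRange.exists_factor {n : ℕ} {τ m M : ℝ} (hR : IsRadiusRange n τ m M) :
    ∃ q : Polynomial ℝ, (∀ r, radialPotential n τ r = (r - m) * (M - r) * q.eval r) ∧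
      ∀ r ∈ Icc m M, 0 < q.eval r := by
  let P : Polynomial ℝ :=
    Polynomial.X ^ (2 * n - 2) - (Polynomial.X ^ n + Polynomial.C τ) ^ 2
  have hP : ∀ r, P.eval r = radialPotential n τ r := fun r => by simp [P, radialPotential]
  obtain ⟨P₁, hP₁⟩ := Polynomial.dvd_iff_isRoot.2 (show P.IsRoot m by
    rw [Polynomial.IsRoot, hP, hR.neck])
  have h1 : P₁.IsRoot M := by
    have h := hP M
    rw [hP₁, hR.bulge] at h
    simpa [sub_ne_zero.2 hR.lt.ne'] using h
  obtain ⟨P₂, hP₂⟩ := Polynomial.dvd_iff_isRoot.2 h1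
  have hfac : ∀ r, radialPotential n τ r = (r - m) * (M - r) * (-P₂).eval r := fun r => by
    rw [← hP, hP₁, hP₂]; simp; ring
  refine ⟨-P₂, hfac, ?_⟩
  obtain ⟨κ, hκ, hlow⟩ := hR.lower
  have hint : Ioo m M ⊆ {r | κ ≤ (-P₂).eval r} := fun r hr => by
    have h := hlow r (Ioo_subset_Icc_self hr)
    rw [hfac, mul_comm κ] at h
    exact le_of_mul_le_mul_left h (mul_pos (sub_pos.2 hr.1) (sub_pos.2 hr.2))
  have hcl : IsClosed {r | κ ≤ (-P₂).eval r} :=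
    isClosed_le continuous_const (-P₂).continuous
  intro r hr
  have := hcl.closure_subset_iff.2 hint
  rw [closure_Ioo hR.lt.ne] at this
  exact hκ.trans_le (this hr)

/-- An integral over the range of `θ ↦ (m+M)/2 + (M-m)/2 cos θ`, pulled back to angles. -/
theorem integral_Ioo_eq_integral_cos {m M : ℝ} (hlt : m < M) (g : ℝ → ℝ) :
    ∫ x in Ioo m M, g x = ∫ θ in Ioo 0 Real.pi,
      ((M - m) / 2 * Real.sin θ) * g ((m + M) / 2 + (M - m) / 2 * Real.cos θ) := by
  have hB : 0 < (M - m) / 2 := by linarith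
  have himg : (fun θ => (m + M) / 2 + (M - m) / 2 * Real.cos θ) '' Ioo 0 Real.pi = Ioo m M := by
    ext x
    constructor
    · rintro ⟨θ, hθ, rfl⟩
      have h0 := Real.sin_pos_of_mem_Ioo hθ
      have h1 := Real.sin_sq_add_cos_sq θ
      have h2 : Real.cos θ < 1 := by nlinarith
      have h3 : -1 < Real.cos θ := by nlinarith
      constructor <;> simp only <;> nlinarith
    · rintro ⟨h1, h2⟩
      have h3 : (x - (m + M) / 2) / ((M - m) / 2) < 1 := by
        rw [div_lt_one hB]; linarith
      have h4 : -1 < (x - (m + M) / 2) / ((M - m) / 2) := by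
        rw [lt_div_iff₀ hB]; linarith
      refine ⟨Real.arccos ((x - (m + M) / 2) / ((M - m) / 2)), ⟨Real.arccos_pos.2 h3, ?_⟩, ?_⟩
      · refine lt_of_le_of_ne (Real.arccos_le_pi _) fun h => ?_
        exact absurd (Real.arccos_eq_pi.1 h) (not_le.2 h4)
      · simp only
        rw [Real.cos_arccos h4.le h3.le, mul_div_cancel₀ _ hB.ne']
        ring
  rw [← himg, integral_image_eq_integral_abs_deriv_smul
    (f' := fun θ => (M - m) / 2 * -Real.sin θ) measurableSet_Ioo]
  · refine setIntegral_congr_fun measurableSet_Ioo fun θ hθ => ?_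
    have h0 := Real.sin_pos_of_mem_Ioo hθ
    simp only [smul_eq_mul]
    rw [mul_neg, abs_neg, abs_of_pos (by positivity)]
  · intro θ _
    exact (((Real.hasDerivAt_cos θ).const_mul _).const_add _).hasDerivWithinAt
  · intro a ha b hb hab
    simp only [add_right_inj, mul_eq_mul_left_iff, hB.ne', or_false] at hab
    exact Real.injOn_cos (Ioo_subset_Icc_self ha) (Ioo_subset_Icc_self hb) hab

/-- Existence of the Delaunay profile with given range of radii, with its least period and the
axial displacement over it. The radius is `(m+M)/2 + (M-m)/2 cos θ` with `θ` solving an angle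
equation. -/
theorem IsRadiusRange.exists_profile {n : ℕ} (hn : 2 ≤ n) {τ m M : ℝ}
    (hR : IsRadiusRange n τ m M) :
    ∃ (r k : ℝ → ℝ) (L : ℝ), IsDelaunayProfile n τ r k ∧
      IsLeast {T : ℝ | 0 < T ∧ Function.Periodic r T} L ∧
      k L = 2 * ∫ x in Ioo m M, (x ^ n + τ) / √(radialPotential n τ x) := by
  obtain ⟨q, hq, hqpos⟩ := hR.exists_factor
  have hlt := hR.lt
  have hm := hR.pos
  set A := (m + M) / 2 with hA
  set B := (M - m) / 2 with hB
  have hB0 : 0 < B := by rw [hB]; linarith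
  set ρ : ℝ → ℝ := fun θ => A + B * Real.cos θ with hρ
  have hρmem : ∀ θ, ρ θ ∈ Icc m M := fun θ => by
    have h1 := Real.neg_one_le_cos θ
    have h2 := Real.cos_le_one θ
    constructor <;> simp only [hρ, hA, hB] <;> nlinarith
  have hρpos : ∀ θ, 0 < ρ θ := fun θ => hm.trans_le (hρmem θ).1
  have hρfac : ∀ θ, (ρ θ - m) * (M - ρ θ) = (B * Real.sin θ) ^ 2 := fun θ => by
    rw [mul_pow, Real.sin_sq]; simp only [hρ, hA, hB]; ring
  have hρd : ∀ θ, HasDerivAt ρ (-(B * Real.sin θ)) θ := fun θ =>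
    (((Real.hasDerivAt_cos θ).const_mul B).const_add A).congr_deriv (by ring)
  have hρC : ContDiff ℝ 2 ρ := contDiff_const.add (contDiff_const.mul Real.contDiff_cos)
  set ω : ℝ → ℝ := fun θ => √(q.eval (ρ θ)) / ρ θ ^ (n - 2) with hω
  have hωC : ContDiff ℝ 2 ω := by
    refine ContDiff.div (ContDiff.sqrt ?_ fun θ => (hqpos _ (hρmem θ)).ne') (hρC.pow _)
      fun θ => (pow_pos (hρpos θ) _).ne'
    simpa [Function.comp_def] using (Polynomial.contDiff_aeval q 2 (𝕜 := ℝ) (R := ℝ)).comp hρC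
  have hωpos : ∀ θ, 0 < ω θ := fun θ =>
    div_pos (Real.sqrt_pos.2 (hqpos _ (hρmem θ))) (pow_pos (hρpos θ) _)
  have hρper : ∀ θ, ρ (θ + 2 * Real.pi) = ρ θ := fun θ => by simp [hρ]
  have hωper : Function.Periodic ω (2 * Real.pi) := fun θ => by
    simp only [hω, hρper]
  have hωsq : ∀ θ, (B * Real.sin θ * ω θ) ^ 2 = ρ θ ^ 2 - axisSpeed n τ (ρ θ) ^ 2 := fun θ => by
    have h1 := radialPotential_eq hn τ (hρpos θ)
    rw [hq, hρfac] at h1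
    have h2 := hρpos θ
    have h3 : ω θ ^ 2 * ρ θ ^ (2 * (n - 2)) = q.eval (ρ θ) := by
      rw [hω]; simp only
      rw [div_pow, Real.sq_sqrt (hqpos _ (hρmem θ)).le, ← pow_mul, mul_comm (n - 2) 2]
      field_simp
    have h4 : (0 : ℝ) < ρ θ ^ (2 * (n - 2)) := pow_pos h2 _
    apply mul_left_cancel₀ h4.ne'
    rw [← h1, ← h3]; ring
  obtain ⟨θ, L, hL, hθ0, hθd, hθmono, hθL⟩ := exists_angle_solution hωC.continuous hωpos hωper
  have hθ1 : Differentiable ℝ θ := fun t => (hθd t).differentiableAt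
  have hθderiv : deriv θ = fun t => ω (θ t) := funext fun t => (hθd t).deriv
  have hθC1 : ContDiff ℝ 1 θ := contDiff_one_iff_deriv.2
    ⟨hθ1, by rw [hθderiv]; exact hωC.continuous.comp hθ1.continuous⟩
  have hθC : ContDiff ℝ 2 θ := by
    refine (contDiff_succ_iff_deriv (n := 1)).2 ⟨hθ1, by simp, ?_⟩
    rw [hθderiv]
    exact (hωC.of_le (by norm_num)).comp hθC1
  set r : ℝ → ℝ := fun t => ρ (θ t) with hr
  have hrC : ContDiff ℝ 2 r := hρC.comp hθC
  have hrd : ∀ t, HasDerivAt r (-(B * Real.sin (θ t)) * ω (θ t)) t := fun t =>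
    (hρd (θ t)).comp t (hθd t)
  have hrpos : ∀ t, 0 < r t := fun t => hρpos _
  have hsC : ContDiff ℝ 2 fun t => axisSpeed n τ (r t) := contDiff_iff_contDiffAt.2 fun t =>
    (contDiffAt_axisSpeed n τ (hrpos t)).comp t hrC.contDiffAt
  set k : ℝ → ℝ := fun t => ∫ s in (0 : ℝ)..t, axisSpeed n τ (r s) with hk
  have hkd : ∀ t, HasDerivAt k (axisSpeed n τ (r t)) t := fun t =>
    intervalIntegral.integral_hasDerivAt_right (hsC.continuous.intervalIntegrable _ _)
      hsC.continuous.aestronglyMeasurable.stronglyMeasurableAtFilter hsC.continuous.continuousAt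
  have hkderiv : deriv k = fun t => axisSpeed n τ (r t) := funext fun t => (hkd t).deriv
  have hkC : ContDiff ℝ 2 k := by
    refine (contDiff_succ_iff_deriv (n := 1)).2 ⟨fun t => (hkd t).differentiableAt, by simp, ?_⟩
    rw [hkderiv]
    exact hsC.of_le (by norm_num)
  have hconf : ∀ t, deriv r t ^ 2 + axisSpeed n τ (r t) ^ 2 = r t ^ 2 := fun t => by
    rw [(hrd t).deriv]
    have := hωsq (θ t)
    simp only [hr]
    linear_combination this
  -- The second-order equation holds off the zeros of `r'`, which are isolated.
  have hrr : ∀ t, deriv (deriv r) t = radialForce n τ (r t) := by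
    intro t
    have h0 : ∀ s, Real.sin (θ s) ≠ 0 → deriv (deriv r) s = radialForce n τ (r s) := by
      intro s hs
      have h1 := deriv_mul_deriv_deriv_sub_radialForce hn hrC hrpos hconf s
      rw [(hrd s).deriv] at h1
      have h2 := (hωpos (θ s)).ne'
      have h3 : -(B * Real.sin (θ s)) * ω (θ s) ≠ 0 :=
        mul_ne_zero (neg_ne_zero.2 (mul_ne_zero hB0.ne' hs)) h2
      exact sub_eq_zero.1 ((mul_eq_zero.1 h1).resolve_left h3)
    by_cases hs : Real.sin (θ t) = 0
    · have hcos : Real.cos (θ t) ≠ 0 := fun h => by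
        have := Real.sin_sq_add_cos_sq (θ t)
        rw [hs, h] at this; norm_num at this
      have hne : ∀ᶠ s in 𝓝[≠] t, Real.sin (θ s) ≠ 0 :=
        ((hθd t).sin).eventually_ne (mul_ne_zero hcos (hωpos _).ne')
      have hc1 : Continuous (deriv (deriv r)) :=
        (contDiff_one_iff_deriv.1 ((contDiff_succ_iff_deriv (n := 1)).1 hrC).2.2).2
      have hc2 : Continuous fun s => radialForce n τ (r s) := continuous_iff_continuousAt.2
        fun s => ((contDiffAt_radialForce n τ (hrpos s) (i := 0)).continuousAt).comp
          (hrd s).continuousAt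
      exact tendsto_nhds_unique (hc1.continuousAt.tendsto.mono_left nhdsWithin_le_nhds)
        ((hc2.continuousAt.tendsto.mono_left nhdsWithin_le_nhds).congr'
          (hne.mono fun s hs => (h0 s hs).symm))
    · exact h0 t hs
  have hconf' : ∀ t, deriv r t ^ 2 + deriv k t ^ 2 = r t ^ 2 := fun t => by
    rw [hkderiv]; exact hconf t
  refine ⟨r, k, L, ⟨hrC, hkC, hrpos, hconf', ?_, ?_, ?_, ?_⟩, ⟨⟨hL, ?_⟩, ?_⟩, ?_⟩
  · intro t
    have := (pow_pos (hrpos t) (n - 2)).ne'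
    rw [hkderiv]
    simp only [axisSpeed]
    field_simp
    ring
  · intro t
    rw [revolutionMeanCurvature_eq_one_iff hn (hrC.differentiable (by norm_num)) hrpos hkderiv
      hconf', hrr]
    ring
  · intro t
    simp only [hr, hρ, hθ0, Real.cos_zero]
    have := Real.cos_le_one (θ t)
    nlinarith
  · simp [hk]
  · intro t
    simp only [hr, hθL, hρper]
  · rintro T ⟨hT, hTper⟩
    have h1 : r T = r 0 := by simpa using hTper 0
    simp only [hr, hρ, hθ0, Real.cos_zero, add_right_inj, mul_eq_mul_left_iff, hB0.ne',
      or_false] at h1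
    obtain ⟨j, hj⟩ := (Real.cos_eq_one_iff _).1 h1
    have hθT : 0 < θ T := hθ0 ▸ hθmono hT
    have hj1 : (1 : ℤ) ≤ j := by
      by_contra hcon
      have : (j : ℝ) ≤ 0 := by exact_mod_cast (show j ≤ 0 by omega)
      have := Real.two_pi_pos
      nlinarith
    have hj2 : (1 : ℝ) ≤ j := by exact_mod_cast hj1
    have : θ L ≤ θ T := by
      have := hθL 0
      rw [zero_add, hθ0, zero_add] at this
      rw [this, ← hj]
      have := Real.two_pi_pos
      nlinarith
    exact hθmono.le_iff_le.1 this
  · have hHc : Continuous fun x => axisSpeed n τ (ρ x) / ω x := by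
      refine Continuous.div ?_ hωC.continuous fun x => (hωpos x).ne'
      exact continuous_iff_continuousAt.2 fun x =>
        ((contDiffAt_axisSpeed n τ (hρpos x) (i := 0)).continuousAt).comp (hρd x).continuousAt
    have hθL0 : θ L = 2 * Real.pi := by simpa [hθ0] using hθL 0
    have h1 : k L = ∫ x in (0 : ℝ)..(2 * Real.pi), axisSpeed n τ (ρ x) / ω x := by
      have h := intervalIntegral.integral_comp_mul_deriv (a := 0) (b := L) (f := θ)
        (f' := fun t => ω (θ t)) (fun t _ => hθd t)
        (hωC.continuous.comp hθ1.continuous).continuousOn hHc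
      rw [hθ0, hθL0] at h
      rw [← h, hk]
      refine intervalIntegral.integral_congr fun t _ => ?_
      simp only [Function.comp, hr]
      rw [div_mul_cancel₀ _ (hωpos _).ne']
    have h2 : ∫ x in Real.pi..(2 * Real.pi), axisSpeed n τ (ρ x) / ω x =
        ∫ x in (0 : ℝ)..Real.pi, axisSpeed n τ (ρ x) / ω x := by
      have h := intervalIntegral.integral_comp_sub_left (a := Real.pi) (b := 2 * Real.pi)
        (fun x => axisSpeed n τ (ρ x) / ω x) (2 * Real.pi)
      rw [sub_self, show 2 * Real.pi - Real.pi = Real.pi by ring] at h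
      rw [← h]
      refine intervalIntegral.integral_congr fun x _ => ?_
      have : ρ (2 * Real.pi - x) = ρ x := by simp [hρ]
      simp only [hω, this]
    rw [h1, ← intervalIntegral.integral_add_adjacent_intervals (hHc.intervalIntegrable 0 Real.pi)
      (hHc.intervalIntegrable _ _), h2, ← two_mul, integral_Ioo_eq_integral_cos hlt,
      intervalIntegral.integral_of_le Real.pi_pos.le, integral_Ioc_eq_integral_Ioo]
    congr 1
    refine setIntegral_congr_fun measurableSet_Ioo fun x hx => ?_
    have hsin := Real.sin_pos_of_mem_Ioo hx
    have hb : 0 < B * Real.sin x := mul_pos hB0 hsin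
    have h3 : radialPotential n τ (ρ x) = (B * Real.sin x) ^ 2 * q.eval (ρ x) := by
      rw [hq, hρfac]
    have h4 := pow_pos (hρpos x) (n - 2)
    have h5 := Real.sqrt_pos.2 (hqpos _ (hρmem x))
    change axisSpeed n τ (ρ x) / ω x =
      B * Real.sin x * ((ρ x ^ n + τ) / √(radialPotential n τ (ρ x)))
    rw [h3, Real.sqrt_mul (sq_nonneg _), Real.sqrt_sq hb.le]
    simp only [hω, axisSpeed]
    field_simp

/-! ### The neck and bulge roots -/

/-- For `τ = σ e`, the `(n-1)`-st powers `u` and `v` of the neck and bulge radii as functions of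
`e ∈ (0, δ)`, with derivatives `u'` and `v'`; here `α = 1 / (n-1)` and `σ = ±1`. The bound on `δ` is
half the value of `y - y ^ (1 + α)` at `y = 1/2`, and the upper bound on `u` says that the neck
radius `u ^ α` is less than `1/4`. -/
structure IsRootPair (α σ δ K : ℝ) (u v u' v' : ℝ → ℝ) : Prop where
  δ_pos : 0 < δ
  K_pos : 0 < K
  δ_le : δ ≤ (1 / 2 - (1 / 2) ^ (1 + α)) / 2
  u_eq : ∀ e ∈ Ioo 0 δ, u e - σ * u e ^ (1 + α) = e
  v_eq : ∀ e ∈ Ioo 0 δ, v e - v e ^ (1 + α) = σ * e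
  u_lower : ∀ e ∈ Ioo 0 δ, e / 2 ≤ u e
  u_upper : ∀ e ∈ Ioo 0 δ, u e < (1 / 4) ^ (1 / α)
  v_mem : ∀ e ∈ Ioo 0 δ, v e ∈ Ioo (3 / 4) (5 / 4)
  u_deriv : ∀ e ∈ Ioo 0 δ, HasDerivAt u (u' e) e
  v_deriv : ∀ e ∈ Ioo 0 δ, HasDerivAt v (v' e) e
  u'_le : ∀ e ∈ Ioo 0 δ, |u' e| ≤ K
  v'_le : ∀ e ∈ Ioo 0 δ, |v' e| ≤ K
  u_div : Tendsto (fun e => u e / e) (𝓝[>] 0) (𝓝 1)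
  u'_lim : Tendsto u' (𝓝[>] 0) (𝓝 1)
  v_lim : Tendsto v (𝓝[>] 0) (𝓝 1)
  v'_lim : ∃ c, Tendsto v' (𝓝[>] 0) (𝓝 c)

theorem exists_local_right_inverse {f : ℝ → ℝ} (hf : ContDiff ℝ 1 f) {x f' : ℝ}
    (hd : HasDerivAt f f' x) (hf' : f' ≠ 0) :
    ∃ g : ℝ → ℝ, g (f x) = x ∧ ContDiffAt ℝ 1 g (f x) ∧ ∀ᶠ y in 𝓝 (f x), f (g y) = y := by
  have hF : HasFDerivAt f (ContinuousLinearEquiv.unitsEquivAut ℝ (Units.mk0 f' hf') :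
      ℝ →L[ℝ] ℝ) x := by
    refine hd.hasFDerivAt.congr_fderiv ?_
    ext; simp
  have h := hf.contDiffAt (x := x)
  refine ⟨h.localInverse hF one_ne_zero, ?_, h.to_localInverse hF one_ne_zero, ?_⟩
  · exact h.localInverse_apply_image hF one_ne_zero
  · exact (h.hasStrictFDerivAt' hF one_ne_zero).eventually_right_inverse

theorem contDiff_sub_abs_rpow {α : ℝ} (hα : 0 < α) (σ : ℝ) :
    ContDiff ℝ 1 fun y : ℝ => y - σ * |y| ^ (1 + α) := by
  simpa using contDiff_id.sub
    (contDiff_const.mul (contDiff_norm_rpow (E := ℝ) (show 1 < 1 + α by linarith)))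

theorem hasDerivAt_sub_abs_rpow {α : ℝ} (hα : 0 < α) (σ y : ℝ) :
    HasDerivAt (fun y : ℝ => y - σ * |y| ^ (1 + α))
      (1 - σ * ((1 + α) * |y| ^ (1 + α - 2) * y)) y :=
  (hasDerivAt_id y).sub ((hasDerivAt_abs_rpow y (show 1 < 1 + α by linarith)).const_mul σ)

/-- The roots are local inverses of `y ↦ y - σ |y|^(1+α)` at `0` and of `y ↦ y - |y|^(1+α)` at `1`,
both continuously differentiable on all of `ℝ`. -/
theorem exists_isRootPair {α : ℝ} (hα : 0 < α) (σ : ℝ) :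
    ∃ δ K u v u' v', IsRootPair α σ δ K u v u' v' := by
  have h1α : 1 + α ≠ 0 := by positivity
  have hc0 : (0 : ℝ) < (1 / 2 - (1 / 2) ^ (1 + α)) / 2 := by
    have : ((1 : ℝ) / 2) ^ (1 + α) < (1 / 2) ^ (1 : ℝ) :=
      Real.rpow_lt_rpow_of_exponent_gt (by norm_num) (by norm_num) (by linarith)
    rw [Real.rpow_one] at this
    linarith
  have hc1 : (0 : ℝ) < (1 / 4) ^ (1 / α) := by positivity
  -- the root near `0`
  have hd0 := hasDerivAt_sub_abs_rpow hα σ 0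
  obtain ⟨u, hu0, huC, hu⟩ := exists_local_right_inverse (contDiff_sub_abs_rpow hα σ) hd0 (by simp)
  -- the root near `1`
  have hd1 := hasDerivAt_sub_abs_rpow hα 1 1
  obtain ⟨w, hw0, hwC, hw⟩ := exists_local_right_inverse (contDiff_sub_abs_rpow hα 1) hd1
    (by simp [hα.ne'])
  simp only [abs_zero, Real.zero_rpow h1α, mul_zero, sub_zero] at hu0 huC hu
  simp only [abs_one, Real.one_rpow, mul_one, sub_self, one_mul] at hw0 hwC hw
  have hu1 : HasDerivAt u (deriv u 0) 0 := (huC.differentiableAt one_ne_zero).hasDerivAt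
  have hder : deriv u 0 = 1 := by
    have hd0' : HasDerivAt (fun y : ℝ => y - σ * |y| ^ (1 + α)) 1 (u 0) := by
      rw [hu0]; simpa using hd0
    have h2 := hd0'.comp 0 hu1
    have h3 : (fun y : ℝ => y - σ * |y| ^ (1 + α)) ∘ u =ᶠ[𝓝 0] id := hu
    have := (h2.congr_of_eventuallyEq h3.symm).unique (hasDerivAt_id 0)
    simpa using this
  have hmul : Tendsto (fun e : ℝ => σ * e) (𝓝[>] 0) (𝓝 0) := by
    have : Tendsto (fun e : ℝ => σ * e) (𝓝 0) (𝓝 (σ * 0)) := (continuous_const_mul σ).tendsto 0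
    rw [mul_zero] at this
    exact this.mono_left nhdsWithin_le_nhds
  have hud : ∀ᶠ e in 𝓝[>] 0, DifferentiableAt ℝ u e :=
    ((huC.eventually (by simp)).filter_mono nhdsWithin_le_nhds).mono
      fun e h => h.differentiableAt one_ne_zero
  have hwd : ∀ᶠ e in 𝓝[>] 0, DifferentiableAt ℝ w (σ * e) :=
    (hmul.eventually (hwC.eventually (by simp))).mono
      fun e h => h.differentiableAt one_ne_zero
  have hucont : Tendsto u (𝓝[>] 0) (𝓝 0) := by
    have := huC.continuousAt.tendsto
    rw [hu0] at this
    exact this.mono_left nhdsWithin_le_nhds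
  have hwcont : Tendsto (fun e => w (σ * e)) (𝓝[>] 0) (𝓝 1) := by
    have := hwC.continuousAt.tendsto
    rw [hw0] at this
    exact this.comp hmul
  have hu'lim : Tendsto (deriv u) (𝓝[>] 0) (𝓝 1) := by
    have := ((huC.derivWithin (m := 0) (by simp)).continuousAt).tendsto
    rw [hder] at this
    exact this.mono_left nhdsWithin_le_nhds
  have hw'lim : Tendsto (fun e => deriv w (σ * e)) (𝓝[>] 0) (𝓝 (deriv w 0)) :=
    ((hwC.derivWithin (m := 0) (by simp)).continuousAt).tendsto.comp hmul
  have hudiv : Tendsto (fun e => u e / e) (𝓝[>] 0) (𝓝 1) := by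
    have := hu1.tendsto_slope_zero_right
    rw [hder] at this
    refine this.congr fun e => ?_
    simp [hu0, div_eq_inv_mul]
  set K := max 2 (|σ| * (|deriv w 0| + 1)) with hK
  have hev : ∀ᶠ e in 𝓝[>] (0 : ℝ), e ≤ (1 / 2 - (1 / 2) ^ (1 + α)) / 2 ∧
      u e - σ * u e ^ (1 + α) = e ∧ w (σ * e) - w (σ * e) ^ (1 + α) = σ * e ∧
      e / 2 ≤ u e ∧ u e < (1 / 4) ^ (1 / α) ∧ w (σ * e) ∈ Ioo (3 / 4 : ℝ) (5 / 4) ∧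
      HasDerivAt u (deriv u e) e ∧ HasDerivAt (fun e => w (σ * e)) (deriv w (σ * e) * σ) e ∧
      |deriv u e| ≤ K ∧ |deriv w (σ * e) * σ| ≤ K := by
    filter_upwards [self_mem_nhdsWithin, nhdsWithin_le_nhds (Iio_mem_nhds hc0),
      nhdsWithin_le_nhds hu, hmul.eventually hw, hudiv.eventually (lt_mem_nhds one_half_lt_one),
      hucont.eventually (gt_mem_nhds hc1),
      hwcont.eventually (Ioo_mem_nhds (show (3 / 4 : ℝ) < 1 by norm_num)
        (show (1 : ℝ) < 5 / 4 by norm_num)), hud, hwd,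
      (hu'lim.abs).eventually (gt_mem_nhds (show |(1 : ℝ)| < 2 by norm_num)),
      (hw'lim.abs).eventually (gt_mem_nhds (lt_add_one _))] with
      e he h1 h2 h3 h4 h5 h6 h7 h8 h9 h10
    rw [mem_Ioi] at he
    rw [lt_div_iff₀ he] at h4
    have hue : 0 < u e := by linarith
    have hwe : 0 < w (σ * e) := by linarith [h6.1]
    rw [abs_of_pos hue] at h2
    rw [abs_of_pos hwe] at h3
    refine ⟨le_of_lt h1, h2, h3, by linarith, h5, h6, h7.hasDerivAt, ?_, ?_, ?_⟩
    · have h := h8.hasDerivAt.comp e ((hasDerivAt_id e).const_mul σ)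
      simpa [Function.comp_def] using h
    · exact h9.le.trans (le_max_left _ _)
    · rw [abs_mul, mul_comm]
      exact (mul_le_mul_of_nonneg_left h10.le (abs_nonneg _)).trans (le_max_right _ _)
  obtain ⟨δ, hδ, hδe⟩ := mem_nhdsGT_iff_exists_Ioo_subset.1 hev
  rw [mem_Ioi] at hδ
  refine ⟨min δ ((1 / 2 - (1 / 2) ^ (1 + α)) / 2), K, u, fun e => w (σ * e), deriv u,
    fun e => deriv w (σ * e) * σ, ?_⟩
  have hsub : ∀ e ∈ Ioo 0 (min δ ((1 / 2 - (1 / 2) ^ (1 + α)) / 2)), e ∈ Ioo 0 δ :=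
    fun e he => ⟨he.1, he.2.trans_le (min_le_left _ _)⟩
  exact {
    δ_pos := lt_min hδ hc0
    K_pos := lt_of_lt_of_le two_pos (le_max_left _ _)
    δ_le := min_le_right _ _
    u_eq := fun e he => (hδe (hsub e he)).2.1
    v_eq := fun e he => (hδe (hsub e he)).2.2.1
    u_lower := fun e he => (hδe (hsub e he)).2.2.2.1
    u_upper := fun e he => (hδe (hsub e he)).2.2.2.2.1
    v_mem := fun e he => (hδe (hsub e he)).2.2.2.2.2.1
    u_deriv := fun e he => (hδe (hsub e he)).2.2.2.2.2.2.1
    v_deriv := fun e he => (hδe (hsub e he)).2.2.2.2.2.2.2.1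
    u'_le := fun e he => (hδe (hsub e he)).2.2.2.2.2.2.2.2.1
    v'_le := fun e he => (hδe (hsub e he)).2.2.2.2.2.2.2.2.2
    u_div := hudiv
    u'_lim := hu'lim
    v_lim := hwcont
    v'_lim := ⟨_, hw'lim.mul_const σ⟩ }

/-! ### Lower bounds from concavity -/

theorem concaveOn_sub_rpow {α : ℝ} (hα : 0 < α) :
    ConcaveOn ℝ (Ici 0) fun y : ℝ => y - y ^ (1 + α) :=
  (concaveOn_id (convex_Ici 0)).sub (convexOn_rpow (by linarith))

/-- A concave function lies above its chords. -/
theorem ConcaveOn.chord_le {f : ℝ → ℝ} {s : Set ℝ} (hf : ConcaveOn ℝ s f) {a b y : ℝ} (ha : a ∈ s)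
    (hb : b ∈ s) (hab : a < b) (h1 : a ≤ y) (h2 : y ≤ b) :
    (b - y) * f a + (y - a) * f b ≤ (b - a) * f y := by
  have hd : 0 < b - a := sub_pos.2 hab
  have h := hf.2 ha hb (show 0 ≤ (b - y) / (b - a) from div_nonneg (by linarith) hd.le)
    (show 0 ≤ (y - a) / (b - a) from div_nonneg (by linarith) hd.le) (by field_simp; ring)
  simp only [smul_eq_mul] at h
  have e : (b - y) / (b - a) * a + (y - a) / (b - a) * b = y := by field_simp; ring
  rw [e] at h
  have := mul_le_mul_of_nonneg_left h hd.le
  refine le_trans (le_of_eq ?_) this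
  field_simp

/-- The defining relations of the two roots at one value of `e`, with room to spare. -/
structure IsRoots (α σ e u v : ℝ) : Prop where
  α_pos : 0 < α
  sign : σ = 1 ∨ σ = -1
  e_pos : 0 < e
  e_le : e ≤ (1 / 2 - (1 / 2) ^ (1 + α)) / 2
  u_pos : 0 < u
  u_lt : u < 1 / 4
  u_eq : u - σ * u ^ (1 + α) = e
  v_mem : v ∈ Ioo (3 / 4 : ℝ) (5 / 4)
  v_eq : v - v ^ (1 + α) = σ * e

theorem IsRoots.half_lower {α σ e u v : ℝ} (h : IsRoots α σ e u v) :
    (1 / 2 - (1 / 2) ^ (1 + α)) / 2 ≤ 1 / 2 - (1 / 2 : ℝ) ^ (1 + α) - σ * e := by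
  have h1 := h.e_pos
  have h2 := h.e_le
  rcases h.sign with h3 | h3 <;> rw [h3] <;> linarith

/-- The discriminant `y² - (y^(1+α) + τ)²`, with `y` the `(n-1)`-st power of the radius, vanishes
at most linearly at the two roots, uniformly in the force parameter. It is the product of
`y - y^(1+α) - τ`, bounded below by chords, and `y + y^(1+α) + τ`. -/
theorem IsRoots.discr_lower {α σ e u v : ℝ} (h : IsRoots α σ e u v) {y : ℝ} (hy : y ∈ Icc u v) :
    (1 / 2 - (1 / 2) ^ (1 + α)) / 8 * (y * ((y - u) * (v - y))) ≤
      y ^ 2 - (y ^ (1 + α) + σ * e) ^ 2 := by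
  have hhalf := h.half_lower
  have hc0 : 0 < (1 / 2 - (1 / 2 : ℝ) ^ (1 + α)) / 2 := h.e_pos.trans_le h.e_le
  set c := (1 / 2 - (1 / 2 : ℝ) ^ (1 + α)) / 2 with hc
  have hcv := concaveOn_sub_rpow h.α_pos
  have hu := h.u_pos
  have hu4 := h.u_lt
  have he := h.e_pos
  obtain ⟨hv1, hv2⟩ := h.v_mem
  have hy0 : 0 < y := hu.trans_le hy.1
  -- the first factor, for a left end `w` at which it is non-negative
  have key : ∀ w, 0 ≤ w → w < 1 / 4 → w ≤ y → 0 ≤ w - w ^ (1 + α) - σ * e →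
      c / 4 * ((y - w) * (v - y)) ≤ y - y ^ (1 + α) - σ * e := by
    intro w hw0 hw4 hwy hw
    rcases le_total y (1 / 2) with h2 | h2
    · have h3 := hcv.chord_le (mem_Ici.2 hw0) (mem_Ici.2 (show (0 : ℝ) ≤ 1 / 2 by norm_num))
        (by linarith) hwy h2
      have h4 : (y - w) * c ≤ (1 / 2 - w) * (y - y ^ (1 + α) - σ * e) := by
        have h5 : (y - w) * c ≤ (y - w) * (1 / 2 - (1 / 2 : ℝ) ^ (1 + α) - σ * e) :=
          mul_le_mul_of_nonneg_left hhalf (by linarith)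
        have h6 := mul_nonneg (show 0 ≤ 1 / 2 - y by linarith) hw
        nlinarith
      have h7 : 0 ≤ (y - w) * c := mul_nonneg (by linarith) hc0.le
      have h8 : 0 ≤ y - y ^ (1 + α) - σ * e := by
        by_contra hcon
        push Not at hcon
        nlinarith
      have h9 : (y - w) * c * ((v - y) / 4) ≤ (y - w) * c * 1 :=
        mul_le_mul_of_nonneg_left (by linarith) h7
      nlinarith
    · have h3 := hcv.chord_le (mem_Ici.2 (show (0 : ℝ) ≤ 1 / 2 by norm_num))
        (mem_Ici.2 (show 0 ≤ v by linarith)) (by linarith) h2 hy.2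
      rw [h.v_eq] at h3
      have h4 : (v - y) * c ≤ (v - 1 / 2) * (y - y ^ (1 + α) - σ * e) := by
        have h5 : (v - y) * c ≤ (v - y) * (1 / 2 - (1 / 2 : ℝ) ^ (1 + α) - σ * e) :=
          mul_le_mul_of_nonneg_left hhalf (by linarith [hy.2])
        nlinarith
      have h7 : 0 ≤ (v - y) * c := mul_nonneg (by linarith [hy.2]) hc0.le
      have h8 : 0 ≤ y - y ^ (1 + α) - σ * e := by
        by_contra hcon
        push Not at hcon
        nlinarith
      have h9 : (v - y) * c * ((y - w) / 4) ≤ (v - y) * c * 1 :=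
        mul_le_mul_of_nonneg_left (by linarith [hy.2]) h7
      nlinarith
  have hfac : y ^ 2 - (y ^ (1 + α) + σ * e) ^ 2 =
      (y - y ^ (1 + α) - σ * e) * (y + y ^ (1 + α) + σ * e) := by ring
  rw [hfac]
  have hyu : 0 ≤ y - u := by linarith [hy.1]
  have hvy : 0 ≤ v - y := by linarith [hy.2]
  have hyp : 0 < y ^ (1 + α) := by positivity
  rcases h.sign with hs | hs
  · have h1 := key u hu.le hu4 hy.1 (by have := h.u_eq; rw [hs] at this ⊢; linarith)
    rw [hs] at h1 ⊢
    have h2 : y ≤ y + y ^ (1 + α) + 1 * e := by linarith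
    calc _ = c / 4 * ((y - u) * (v - y)) * y := by rw [hc]; ring
      _ ≤ _ := mul_le_mul h1 h2 hy0.le ((by positivity : (0 : ℝ) ≤ _).trans h1)
  · have h1 := key 0 le_rfl (by norm_num) hy0.le (by
      rw [hs, Real.zero_rpow (by linarith [h.α_pos])]; linarith)
    rw [hs] at h1 ⊢
    have h3 : u ^ (1 + α) ≤ y ^ (1 + α) :=
      Real.rpow_le_rpow hu.le hy.1 (by linarith [h.α_pos])
    have h2 : y - u ≤ y + y ^ (1 + α) + -1 * e := by
      have := h.u_eq; rw [hs] at this; linarith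
    rw [sub_zero] at h1
    calc _ = c / 4 * (y * (v - y)) * (y - u) := by rw [hc]; ring
      _ ≤ _ := mul_le_mul h1 h2 hyu ((by positivity : (0 : ℝ) ≤ _).trans h1)

/-- Non-negativity of the discriminant confines `y` to the interval between the roots. -/
theorem IsRoots.mem_Icc_of_discr_nonneg {α σ e u v : ℝ} (h : IsRoots α σ e u v) {y : ℝ}
    (hy : 0 < y) (hD : 0 ≤ y ^ 2 - (y ^ (1 + α) + σ * e) ^ 2) : y ∈ Icc u v := by
  have hhalf := h.half_lower
  have hc0 : 0 < (1 / 2 - (1 / 2 : ℝ) ^ (1 + α)) / 2 := h.e_pos.trans_le h.e_le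
  have hcv := concaveOn_sub_rpow h.α_pos
  have hu := h.u_pos
  have hu4 := h.u_lt
  have he := h.e_pos
  have hel := h.e_le
  obtain ⟨hv1, hv2⟩ := h.v_mem
  have hyp : 0 < y ^ (1 + α) := by positivity
  have hhp : 0 < (1 / 2 : ℝ) ^ (1 + α) := by positivity
  have hfac : y ^ 2 - (y ^ (1 + α) + σ * e) ^ 2 =
      (y - y ^ (1 + α) - σ * e) * (y + y ^ (1 + α) + σ * e) := by ring
  rw [hfac] at hD
  constructor
  · by_contra hcon
    push Not at hcon
    rcases h.sign with hs | hs
    · have h1 := h.u_eq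
      have h2 := hcv.chord_le (mem_Ici.2 hy.le) (mem_Ici.2 (show (0 : ℝ) ≤ 1 / 2 by norm_num))
        (by linarith) hcon.le (by linarith)
      rw [hs] at h1 hD hhalf
      have h3 : 0 ≤ y - y ^ (1 + α) - 1 * e := nonneg_of_mul_nonneg_left hD (by linarith)
      nlinarith [mul_nonneg (show 0 ≤ 1 / 2 - u by linarith) h3,
        mul_pos (show 0 < u - y by linarith) (hc0.trans_le hhalf)]
    · have h1 := h.u_eq
      rw [hs] at h1 hD
      have h2 : y ^ (1 + α) < u ^ (1 + α) := Real.rpow_lt_rpow hy.le hcon (by linarith [h.α_pos])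
      have h3 : y ^ (1 + α) < y := by
        have := Real.rpow_lt_rpow_of_exponent_gt hy (by linarith) (show (1 : ℝ) < 1 + α by
          linarith [h.α_pos])
        rwa [Real.rpow_one] at this
      nlinarith
  · by_contra hcon
    push Not at hcon
    have h2 := hcv.chord_le (mem_Ici.2 (show (0 : ℝ) ≤ 1 / 2 by norm_num)) (mem_Ici.2 hy.le)
        (by linarith) (show 1 / 2 ≤ v by linarith) hcon.le
    rw [h.v_eq] at h2
    have hZ : 0 < y + y ^ (1 + α) + σ * e := by
      rcases h.sign with hs | hs <;> rw [hs] <;> linarith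
    have h3 : 0 ≤ y - y ^ (1 + α) - σ * e := nonneg_of_mul_nonneg_left hD hZ
    nlinarith [mul_nonneg (show 0 ≤ v - 1 / 2 by linarith) h3,
        mul_pos (show 0 < y - v by linarith) (hc0.trans_le hhalf)]

theorem IsRootPair.isRoots {α σ δ K : ℝ} {u v u' v' : ℝ → ℝ} (h : IsRootPair α σ δ K u v u' v')
    (hα : 0 < α) (hα1 : α ≤ 1) (hσ : σ = 1 ∨ σ = -1) {e : ℝ} (he : e ∈ Ioo 0 δ) :
    IsRoots α σ e (u e) (v e) where
  α_pos := hα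
  sign := hσ
  e_pos := he.1
  e_le := he.2.le.trans h.δ_le
  u_pos := by linarith [h.u_lower e he, he.1]
  u_lt := (h.u_upper e he).trans_le (by
    have h1 : 1 ≤ 1 / α := by rw [le_div_iff₀ hα]; linarith
    simpa using Real.rpow_le_rpow_of_exponent_ge (by norm_num : (0 : ℝ) < 1 / 4)
      (by norm_num : (1 / 4 : ℝ) ≤ 1) h1)
  u_eq := h.u_eq e he
  v_mem := h.v_mem e he
  v_eq := h.v_eq e he

/-- The radii whose `(n-1)`-st powers are the two roots bound the admissible radii. -/
theorem IsRoots.isRadiusRange {N : ℕ} (hN : 1 ≤ N) {σ e u v : ℝ}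
    (h : IsRoots (1 / N) σ e u v) (hu : u < (1 / 4) ^ (1 / (1 / (N : ℝ)))) :
    IsRadiusRange (N + 1) (σ * e) (u ^ (1 / (N : ℝ))) (v ^ (1 / (N : ℝ))) := by
  have hN0 : (N : ℝ) ≠ 0 := by positivity
  have hN' : N ≠ 0 := by omega
  have hpow : ∀ x : ℝ, 0 ≤ x → (x ^ (1 / (N : ℝ))) ^ N = x := fun x hx => by
    rw [one_div, Real.rpow_inv_natCast_pow hx hN']
  have hu0 := h.u_pos
  have hv0 : 0 < v := by linarith [h.v_mem.1]
  have huv : u < v := by linarith [h.v_mem.1, h.u_lt]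
  have hα : 0 < 1 / (N : ℝ) := h.α_pos
  -- the potential in terms of `y = r ^ N`
  have hpot : ∀ r : ℝ, 0 < r → radialPotential (N + 1) (σ * e) r =
      (r ^ N) ^ 2 - ((r ^ N) ^ (1 + 1 / (N : ℝ)) + σ * e) ^ 2 := fun r hr => by
    have h1 : (r ^ N) ^ (1 + 1 / (N : ℝ)) = r ^ (N + 1) := by
      rw [← Real.rpow_natCast, ← Real.rpow_mul hr.le, ← Real.rpow_natCast]
      congr 1
      push_cast
      field_simp
    rw [h1, radialPotential, show 2 * (N + 1) - 2 = N * 2 by omega, pow_mul]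
  have hmpos : 0 < u ^ (1 / (N : ℝ)) := by positivity
  have hMpos : 0 < v ^ (1 / (N : ℝ)) := by positivity
  have hle : ∀ r : ℝ, 0 < r → (r ∈ Icc (u ^ (1 / (N : ℝ))) (v ^ (1 / (N : ℝ))) ↔
      r ^ N ∈ Icc u v) := fun r hr => by
    rw [mem_Icc, mem_Icc, ← pow_le_pow_iff_left₀ hmpos.le hr.le hN', hpow u hu0.le,
      ← pow_le_pow_iff_left₀ hr.le hMpos.le hN', hpow v hv0.le]
  refine ⟨hmpos, Real.rpow_lt_rpow hu0.le huv hα, ?_, ?_, ?_, ?_, ?_⟩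
  · rw [hpot _ hmpos, hpow u hu0.le]
    have h1 := h.u_eq
    rcases h.sign with hs | hs
    · rw [hs] at h1 ⊢
      have : u ^ (1 + 1 / (N : ℝ)) + 1 * e = u := by linarith
      rw [this]; ring
    · rw [hs] at h1 ⊢
      have : u ^ (1 + 1 / (N : ℝ)) + -1 * e = -u := by linarith
      rw [this]; ring
  · rw [hpot _ hMpos, hpow v hv0.le]
    have : v ^ (1 + 1 / (N : ℝ)) + σ * e = v := by linarith [h.v_eq]
    rw [this]; ring
  · set m := u ^ (1 / (N : ℝ)) with hm
    set M := v ^ (1 / (N : ℝ)) with hM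
    have hc0 : 0 < (1 / 2 - (1 / 2 : ℝ) ^ (1 + 1 / (N : ℝ))) / 8 := by
      linarith [h.e_pos.trans_le h.e_le]
    refine ⟨(1 / 2 - (1 / 2) ^ (1 + 1 / (N : ℝ))) / 8 * (u * (m ^ (N - 1) * M ^ (N - 1))),
      by positivity, fun r hr => ?_⟩
    have hr0 : 0 < r := hmpos.trans_le hr.1
    have hrN := (hle r hr0).1 hr
    rw [hpot r hr0]
    refine le_trans ?_ (h.discr_lower hrN)
    rw [mul_assoc]
    refine mul_le_mul_of_nonneg_left ?_ hc0.le
    have hs : ∀ x : ℝ, x ^ N = x * x ^ (N - 1) := fun x => by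
      rw [← pow_succ', Nat.sub_add_cancel hN]
    have h1 : (r - m) * m ^ (N - 1) ≤ r ^ N - u := by
      rw [← hpow u hu0.le, hs r, hs]
      have := pow_le_pow_left₀ hmpos.le hr.1 (N - 1)
      nlinarith
    have h2 : (M - r) * M ^ (N - 1) ≤ v - r ^ N := by
      rw [← hpow v hv0.le, hs r, hs]
      have := pow_le_pow_left₀ hr0.le hr.2 (N - 1)
      nlinarith
    have hr1 := sub_nonneg.2 hr.1
    have hr2 := sub_nonneg.2 hr.2
    calc _ = u * (((r - m) * m ^ (N - 1)) * ((M - r) * M ^ (N - 1))) := by ring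
      _ ≤ r ^ N * ((r ^ N - u) * (v - r ^ N)) := by
        refine mul_le_mul hrN.1 (mul_le_mul h1 h2 (by positivity) (by linarith [hrN.1]))
          (by positivity) (by positivity)
  · intro r hr hp
    rw [hpot r hr] at hp
    exact (hle r hr).2 (h.mem_Icc_of_discr_nonneg (by positivity) hp)
  · have := Real.rpow_lt_rpow hu0.le hu hα
    rw [← Real.rpow_mul (by norm_num), one_div_mul_cancel hα.ne', Real.rpow_one] at this
    linarith

/-! ### The axial density and its derivative in the force parameter -/

/-- The radial potential as a function of `y = r ^ (n-1)`, with `α = 1 / (n-1)`. -/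
noncomputable def discr (α τ y : ℝ) : ℝ := y ^ 2 - (y ^ (1 + α) + τ) ^ 2

/-- The axial displacement of the profile from neck to bulge, as a density in `x ∈ (0, 1)`, where
the `(n-1)`-st power of the radius is `(1 - x) u + x v`. In this coordinate the neck moves by
translation when the force parameter varies, to leading order. -/
noncomputable def axialDensity (α τ u v x : ℝ) : ℝ :=
  α * (v - u) * ((1 - x) * u + x * v) ^ (α - 1) *
    ((((1 - x) * u + x * v) ^ (1 + α) + τ) / √(discr α τ ((1 - x) * u + x * v)))

/-- The numerator in the derivative of `U / √(y² - U²)`, `U = y^(1+α) + σ e`, with respect to `e`,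
when `y` moves with speed `y'`. -/
noncomputable def transportDefect (α σ e y y' : ℝ) : ℝ :=
  σ * y + α * y ^ (1 + α) * y' - σ * e * y'

/-- The derivative of `axialDensity α (σ * e) u v x` with respect to `e`, when `u` and `v` move
with speeds `u'` and `v'`. -/
noncomputable def axialDensityDeriv (α σ e u v u' v' x : ℝ) : ℝ :=
  α * (v - u) * ((1 - x) * u + x * v) ^ (α - 1) *
      (((1 - x) * u + x * v) *
        transportDefect α σ e ((1 - x) * u + x * v) ((1 - x) * u' + x * v') /
        discr α (σ * e) ((1 - x) * u + x * v) / √(discr α (σ * e) ((1 - x) * u + x * v))) +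
    (α * (v - u) * ((α - 1) * ((1 - x) * u + x * v) ^ (α - 2) * ((1 - x) * u' + x * v')) +
      α * (v' - u') * ((1 - x) * u + x * v) ^ (α - 1)) *
      ((((1 - x) * u + x * v) ^ (1 + α) + σ * e) / √(discr α (σ * e) ((1 - x) * u + x * v)))

/-- Roots together with their speeds with respect to `e`, bounded by `K`. -/
structure IsMovingRoots (α σ K e u v u' v' : ℝ) : Prop extends IsRoots α σ e u v where
  α_le : α ≤ 1
  u'_eq : u' - σ * ((1 + α) * u ^ α * u') = 1
  v'_eq : v' - (1 + α) * v ^ α * v' = σ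
  u'_le : |u'| ≤ K
  v'_le : |v'| ≤ K

theorem IsRootPair.isMovingRoots {α σ δ K : ℝ} {u v u' v' : ℝ → ℝ}
    (h : IsRootPair α σ δ K u v u' v') (hα : 0 < α) (hα1 : α ≤ 1) (hσ : σ = 1 ∨ σ = -1) {e : ℝ}
    (he : e ∈ Ioo 0 δ) : IsMovingRoots α σ K e (u e) (v e) (u' e) (v' e) where
  toIsRoots := h.isRoots hα hα1 hσ he
  α_le := hα1
  u'_le := h.u'_le e he
  v'_le := h.v'_le e he
  u'_eq := by
    have hu : u e ≠ 0 := (h.isRoots hα hα1 hσ he).u_pos.ne'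
    have h1 := (h.u_deriv e he).sub
      (((h.u_deriv e he).rpow_const (p := 1 + α) (Or.inl hu)).const_mul σ)
    have h2 : (fun e => u e - σ * u e ^ (1 + α)) =ᶠ[𝓝 e] id := by
      filter_upwards [Ioo_mem_nhds he.1 he.2] with s hs using h.u_eq s hs
    have h3 := (h1.congr_of_eventuallyEq h2.symm).unique (hasDerivAt_id e)
    rw [add_sub_cancel_left] at h3
    linear_combination h3
  v'_eq := by
    have hv : v e ≠ 0 := by
      have := (h.v_mem e he).1
      intro h0; rw [h0] at this; norm_num at this
    have h1 := (h.v_deriv e he).sub ((h.v_deriv e he).rpow_const (p := 1 + α) (Or.inl hv))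
    have h2 : (fun e => v e - v e ^ (1 + α)) =ᶠ[𝓝 e] fun e => σ * e := by
      filter_upwards [Ioo_mem_nhds he.1 he.2] with s hs using h.v_eq s hs
    have h3 := (h1.congr_of_eventuallyEq h2.symm).unique ((hasDerivAt_id e).const_mul σ)
    rw [add_sub_cancel_left] at h3
    linear_combination h3

section bounds

variable {α σ K e u v u' v' x : ℝ}

theorem IsRoots.u_lt_v (h : IsRoots α σ e u v) : u < v := by linarith [h.u_lt, h.v_mem.1]

theorem IsRoots.mem_Icc (h : IsRoots α σ e u v) (hx : x ∈ Icc (0 : ℝ) 1) :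
    (1 - x) * u + x * v ∈ Icc u v := by
  have := h.u_lt_v
  constructor <;> nlinarith [hx.1, hx.2]

theorem IsRoots.e_le_one (h : IsRoots α σ e u v) : e ≤ 1 := by
  have : (0 : ℝ) < (1 / 2) ^ (1 + α) := by positivity
  linarith [h.e_le]

/-- In the coordinate `x` both roots stay at the ends of the interval, so that the defect vanishes
there; it is Lipschitz in `x`, uniformly in `e`. -/
theorem IsMovingRoots.abs_transportDefect_le (h : IsMovingRoots α σ K e u v u' v')
    (hx : x ∈ Icc (0 : ℝ) 1) :
    |transportDefect α σ e ((1 - x) * u + x * v) ((1 - x) * u' + x * v')| ≤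
      (4 + 22 * K) * (x * (1 - x)) := by
  have hα := h.α_pos
  have hα1 := h.α_le
  have hu := h.u_pos
  have huv := h.u_lt_v
  have hv := h.v_mem.2
  have hv0 : 0 < v := hu.trans huv
  have hK : 0 ≤ K := (abs_nonneg _).trans h.u'_le
  have hσ : |σ| = 1 := by rcases h.sign with hs | hs <;> rw [hs] <;> norm_num
  set f : ℝ → ℝ := fun x => transportDefect α σ e ((1 - x) * u + x * v) ((1 - x) * u' + x * v')
    with hf
  set f' : ℝ → ℝ := fun x => σ * (v - u) + α * ((1 + α) * ((1 - x) * u + x * v) ^ α * (v - u) *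
    ((1 - x) * u' + x * v') + ((1 - x) * u + x * v) ^ (1 + α) * (v' - u')) - σ * e * (v' - u')
    with hf'
  have hlin : ∀ a b x : ℝ, HasDerivAt (fun x => (1 - x) * a + x * b) (b - a) x := fun a b x =>
    ((((hasDerivAt_id x).const_sub 1).mul_const a).add
      ((hasDerivAt_id x).mul_const b)).congr_deriv (by ring)
  have hd : ∀ x ∈ Icc (0 : ℝ) 1, HasDerivAt f (f' x) x := by
    intro x hx
    have hy : (1 - x) * u + x * v ≠ 0 := (hu.trans_le (h.mem_Icc hx).1).ne'
    have h1 := ((hlin u v x).const_mul σ).add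
      ((((hlin u v x).rpow_const (p := 1 + α) (Or.inl hy)).const_mul α).mul (hlin u' v' x))
    have h2 := h1.sub ((hlin u' v' x).const_mul (σ * e))
    refine h2.congr_deriv ?_
    rw [hf', add_sub_cancel_left]
    ring
  have hy' : ∀ x ∈ Icc (0 : ℝ) 1, |(1 - x) * u' + x * v'| ≤ K := by
    intro x hx
    have h1 := abs_le.1 h.u'_le
    have h2 := abs_le.1 h.v'_le
    rw [abs_le]
    constructor <;> nlinarith [hx.1, hx.2]
  have huv' : |v' - u'| ≤ 2 * K := by
    have h1 := abs_le.1 h.u'_le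
    have h2 := abs_le.1 h.v'_le
    rw [abs_le]
    constructor <;> linarith
  have hb : ∀ x ∈ Icc (0 : ℝ) 1, ‖f' x‖ ≤ 2 + 11 * K := by
    intro x hx
    have hyv := (h.mem_Icc hx).2
    have hyu := (h.mem_Icc hx).1
    have hy0 := hu.trans_le hyu
    have hp : ∀ b : ℝ, 0 ≤ b → b ≤ 2 → ((1 - x) * u + x * v) ^ b ≤ 2 := by
      intro b hb0 hb2
      calc ((1 - x) * u + x * v) ^ b ≤ (5 / 4 : ℝ) ^ b :=
            Real.rpow_le_rpow hy0.le (by linarith) hb0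
        _ ≤ (5 / 4 : ℝ) ^ (2 : ℝ) := Real.rpow_le_rpow_of_exponent_le (by norm_num) hb2
        _ ≤ 2 := by norm_num
    have hp1 := hp α hα.le (by linarith)
    have hp2 := hp (1 + α) (by linarith) (by linarith)
    have hp1' : 0 < ((1 - x) * u + x * v) ^ α := by positivity
    have hp2' : 0 < ((1 - x) * u + x * v) ^ (1 + α) := by positivity
    rw [Real.norm_eq_abs]
    have t1 : |σ * (v - u)| ≤ 5 / 4 := by
      rw [abs_mul, hσ, one_mul, abs_of_pos (by linarith)]; linarith
    have t2 : |(1 + α) * ((1 - x) * u + x * v) ^ α * (v - u) * ((1 - x) * u' + x * v')| ≤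
        2 * 2 * (5 / 4) * K := by
      rw [abs_mul, abs_mul, abs_mul, abs_of_pos hp1', abs_of_pos (show 0 < 1 + α by linarith),
        abs_of_pos (show 0 < v - u by linarith)]
      have := hy' x hx
      gcongr <;> linarith
    have t3 : |((1 - x) * u + x * v) ^ (1 + α) * (v' - u')| ≤ 2 * (2 * K) := by
      rw [abs_mul, abs_of_pos hp2']
      gcongr
    have t4 : |σ * e * (v' - u')| ≤ 1 * (2 * K) := by
      rw [abs_mul, abs_mul, hσ, one_mul, abs_of_pos h.e_pos]
      have := h.e_le_one
      gcongr
    have t5 : |α * ((1 + α) * ((1 - x) * u + x * v) ^ α * (v - u) * ((1 - x) * u' + x * v') +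
        ((1 - x) * u + x * v) ^ (1 + α) * (v' - u'))| ≤
          1 * (2 * 2 * (5 / 4) * K + 2 * (2 * K)) := by
      rw [abs_mul, abs_of_pos hα]
      gcongr
      exact (abs_add_le _ _).trans (add_le_add t2 t3)
    calc |f' x| ≤ 5 / 4 + 1 * (2 * 2 * (5 / 4) * K + 2 * (2 * K)) + 1 * (2 * K) :=
          (abs_sub _ _).trans (add_le_add ((abs_add_le _ _).trans (add_le_add t1 t5)) t4)
      _ ≤ 2 + 11 * K := by linarith
  have hsplit : ∀ y : ℝ, 0 < y → y ^ (1 + α) = y * y ^ α := fun y hy => by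
    rw [Real.rpow_add hy, Real.rpow_one]
  have hf0 : f 0 = 0 := by
    have h1 := h.u_eq
    have h2 := h.u'_eq
    have h3 : σ * σ = 1 := by rcases h.sign with hs | hs <;> rw [hs] <;> norm_num
    rw [hsplit u hu] at h1
    simp only [hf, transportDefect, sub_zero, one_mul, zero_mul, add_zero]
    rw [hsplit u hu, ← h1]
    linear_combination (-σ * u) * h2 + (-u * u ^ α * u' * α) * h3
  have hf1 : f 1 = 0 := by
    have h1 := h.v_eq
    have h2 := h.v'_eq
    rw [hsplit v hv0] at h1
    simp only [hf, transportDefect, sub_self, one_mul, zero_mul, zero_add]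
    rw [hsplit v hv0, ← h1]
    linear_combination (-v) * h2
  have hL : ∀ a ∈ Icc (0 : ℝ) 1, ∀ b ∈ Icc (0 : ℝ) 1, ‖f b - f a‖ ≤ (2 + 11 * K) * ‖b - a‖ :=
    fun a ha b hb' => (convex_Icc (0 : ℝ) 1).norm_image_sub_le_of_norm_hasDerivWithin_le
      (fun x hx => (hd x hx).hasDerivWithinAt) hb ha hb'
  have e0 := hL 0 (by simp) x hx
  have e1 := hL 1 (by simp) x hx
  rw [hf0, sub_zero, sub_zero, Real.norm_eq_abs, Real.norm_eq_abs, abs_of_nonneg hx.1] at e0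
  rw [hf1, sub_zero, Real.norm_eq_abs, Real.norm_eq_abs, abs_sub_comm,
    abs_of_nonneg (sub_nonneg.2 hx.2)] at e1
  change |f x| ≤ _
  have hC : 0 ≤ 2 + 11 * K := by positivity
  rcases le_total x (1 / 2) with h2 | h2
  · have : (2 + 11 * K) * x ≤ (4 + 22 * K) * (x * (1 - x)) := by
      nlinarith [mul_nonneg (mul_nonneg hC hx.1) (show 0 ≤ 1 - 2 * x by linarith)]
    linarith
  · have : (2 + 11 * K) * (1 - x) ≤ (4 + 22 * K) * (x * (1 - x)) := by
      nlinarith [mul_nonneg (mul_nonneg hC (sub_nonneg.2 hx.2)) (show 0 ≤ 2 * x - 1 by linarith)]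
    linarith

/-- The constant in the lower bound for the discriminant. -/
noncomputable def discrConst (α : ℝ) : ℝ := (1 / 2 - (1 / 2) ^ (1 + α)) / 32

theorem IsRoots.discrConst_pos (h : IsRoots α σ e u v) : 0 < discrConst α := by
  have := h.e_pos.trans_le h.e_le
  unfold discrConst
  linarith

theorem IsRoots.le_discr (h : IsRoots α σ e u v) (hx : x ∈ Icc (0 : ℝ) 1) :
    discrConst α * (((1 - x) * u + x * v) * (x * (1 - x))) ≤
      discr α (σ * e) ((1 - x) * u + x * v) := by
  refine le_trans ?_ (h.discr_lower (h.mem_Icc hx))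
  have hy := h.u_pos.trans_le (h.mem_Icc hx).1
  have h1 : 1 / 4 ≤ (v - u) ^ 2 := by nlinarith [h.u_lt, h.v_mem.1]
  have h2 : ((1 - x) * u + x * v - u) * (v - ((1 - x) * u + x * v)) =
      (v - u) ^ 2 * (x * (1 - x)) := by ring
  rw [h2]
  have h3 : 0 ≤ x * (1 - x) := mul_nonneg hx.1 (sub_nonneg.2 hx.2)
  have h4 : 0 ≤ discrConst α * 4 * ((1 - x) * u + x * v) * (x * (1 - x)) := by
    have := h.discrConst_pos
    positivity
  have e1 : (1 / 2 - (1 / 2 : ℝ) ^ (1 + α)) / 8 = discrConst α * 4 := by unfold discrConst; ring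
  rw [e1]
  nlinarith [mul_le_mul_of_nonneg_left h1 h4]

theorem IsRoots.discr_pos (h : IsRoots α σ e u v) (hx : x ∈ Ioo (0 : ℝ) 1) :
    0 < discr α (σ * e) ((1 - x) * u + x * v) := by
  refine lt_of_lt_of_le ?_ (h.le_discr (Ioo_subset_Icc_self hx))
  have hy := h.u_pos.trans_le (h.mem_Icc (Ioo_subset_Icc_self hx)).1
  have := h.discrConst_pos
  have := hx.1
  have := sub_pos.2 hx.2
  positivity

theorem IsRoots.one_div_sqrt_discr_le (h : IsRoots α σ e u v) (hx : x ∈ Ioo (0 : ℝ) 1) :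
    1 / √(discr α (σ * e) ((1 - x) * u + x * v)) ≤
      1 / √(discrConst α) * (1 / √(((1 - x) * u + x * v) * (x * (1 - x)))) := by
  have hy := h.u_pos.trans_le (h.mem_Icc (Ioo_subset_Icc_self hx)).1
  have hc := h.discrConst_pos
  have h1 := hx.1
  have h2 := sub_pos.2 hx.2
  rw [one_div_mul_one_div, ← Real.sqrt_mul hc.le]
  exact one_div_le_one_div_of_le (by positivity)
    (Real.sqrt_le_sqrt (h.le_discr (Ioo_subset_Icc_self hx)))

theorem IsRoots.abs_numerator_le (h : IsRoots α σ e u v) (hx : x ∈ Ioo (0 : ℝ) 1) :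
    |((1 - x) * u + x * v) ^ (1 + α) + σ * e| ≤ (1 - x) * u + x * v := by
  have hy := h.u_pos.trans_le (h.mem_Icc (Ioo_subset_Icc_self hx)).1
  have := h.discr_pos hx
  unfold discr at this
  exact abs_le_of_sq_le_sq (by linarith) hy.le

theorem IsRoots.abs_axialDensity_le (h : IsRoots α σ e u v) (hα : α ≤ 1)
    (hx : x ∈ Ioo (0 : ℝ) 1) :
    |axialDensity α (σ * e) u v x| ≤ 5 / 4 * (1 / √(discrConst α)) *
      (((1 - x) * u + x * v) ^ α / √(((1 - x) * u + x * v) * (x * (1 - x)))) := by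
  have hy := h.u_pos.trans_le (h.mem_Icc (Ioo_subset_Icc_self hx)).1
  have h1 := h.one_div_sqrt_discr_le hx
  have h2 := h.abs_numerator_le hx
  have hD := Real.sqrt_pos.2 (h.discr_pos hx)
  have huv := h.u_lt_v
  have hα0 := h.α_pos
  unfold axialDensity
  set y := (1 - x) * u + x * v with hy_def
  have hyp : 0 < y ^ (α - 1) := by positivity
  have e1 : y ^ α = y ^ (α - 1) * y := by
    rw [← Real.rpow_add_one hy.ne']; congr 1; ring
  rw [abs_mul, abs_mul, abs_mul, abs_div, abs_of_pos hα0, abs_of_pos (sub_pos.2 huv),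
    abs_of_pos hyp, abs_of_pos hD, e1, div_eq_mul_one_div (|_|)]
  have h3 : α * (v - u) ≤ 5 / 4 := by nlinarith [h.v_mem.2, h.u_pos]
  have h4 : 0 ≤ 1 / √(discr α (σ * e) y) := by positivity
  calc α * (v - u) * y ^ (α - 1) * (|y ^ (1 + α) + σ * e| * (1 / √(discr α (σ * e) y)))
      ≤ 5 / 4 * y ^ (α - 1) *
        (y * (1 / √(discrConst α) * (1 / √(y * (x * (1 - x)))))) := by
        gcongr
    _ = _ := by ring

/-- The derivative of the density is integrable at both ends, and in the neck region it is of
order `y^(α - 3/2) x^(-1/2)`. -/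
theorem IsMovingRoots.abs_axialDensityDeriv_le (h : IsMovingRoots α σ K e u v u' v')
    (hx : x ∈ Ioo (0 : ℝ) 1) :
    |axialDensityDeriv α σ e u v u' v' x| ≤
      ((5 / 4 * ((4 + 22 * K) / discrConst α) + 15 / 4 * K) * (1 / √(discrConst α))) *
      (((1 - x) * u + x * v) ^ (α - 1) / √(((1 - x) * u + x * v) * (x * (1 - x)))) := by
  have hxI := Ioo_subset_Icc_self hx
  have hy := h.u_pos.trans_le (h.mem_Icc hxI).1
  have hyv := (h.mem_Icc hxI).2
  have h1 := h.one_div_sqrt_discr_le hx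
  have h2 := h.abs_numerator_le hx
  have hD0 := h.discr_pos hx
  have hD := Real.sqrt_pos.2 hD0
  have huv := h.u_lt_v
  have hu := h.u_pos
  have hv := h.v_mem.2
  have hα0 := h.α_pos
  have hα1 := h.α_le
  have hΨ := h.abs_transportDefect_le hxI
  have hDl := h.le_discr hxI
  have hc := h.discrConst_pos
  have hK : 0 ≤ K := (abs_nonneg _).trans h.u'_le
  have hw : 0 < x * (1 - x) := mul_pos hx.1 (sub_pos.2 hx.2)
  have hy' : |(1 - x) * u' + x * v'| ≤ K := by
    have h1 := abs_le.1 h.u'_le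
    have h2 := abs_le.1 h.v'_le
    rw [abs_le]
    constructor <;> nlinarith [hx.1, hx.2]
  have huv' : |v' - u'| ≤ 2 * K := by
    have h1 := abs_le.1 h.u'_le
    have h2 := abs_le.1 h.v'_le
    rw [abs_le]
    constructor <;> linarith
  unfold axialDensityDeriv
  set y := (1 - x) * u + x * v with hy_def
  set y' := (1 - x) * u' + x * v' with hy'_def
  set D := discr α (σ * e) y with hD_def
  set Ψ := transportDefect α σ e y y' with hΨ_def
  have hyp : 0 < y ^ (α - 1) := by positivity
  have hyp2 : y ^ (α - 2) * y = y ^ (α - 1) := by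
    rw [← Real.rpow_add_one hy.ne']; congr 1; ring
  have hyp2' : 0 < y ^ (α - 2) := by positivity
  set Q := 1 / √(discrConst α) * (1 / √(y * (x * (1 - x)))) with hQ
  have hQ0 : 0 ≤ Q := by positivity
  have hαv : α * (v - u) ≤ 5 / 4 := by nlinarith
  have hαv0 : 0 ≤ α * (v - u) := mul_nonneg hα0.le (by linarith)
  have r1 : |y * Ψ / D| ≤ (4 + 22 * K) / discrConst α := by
    rw [abs_div, abs_mul, abs_of_pos hy, abs_of_pos hD0, div_le_div_iff₀ hD0 hc]
    have a1 : y * |Ψ| * discrConst α ≤ y * ((4 + 22 * K) * (x * (1 - x))) * discrConst α := by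
      gcongr
    have a2 := mul_le_mul_of_nonneg_left hDl (show 0 ≤ 4 + 22 * K by positivity)
    linarith
  have t1 : |α * (v - u) * y ^ (α - 1) * (y * Ψ / D / √D)| ≤
      5 / 4 * y ^ (α - 1) * ((4 + 22 * K) / discrConst α * Q) := by
    rw [abs_mul, abs_mul, abs_of_nonneg hαv0, abs_of_pos hyp, abs_div, abs_of_pos hD,
      div_eq_mul_one_div _ (√D)]
    gcongr
  have hU : |(y ^ (1 + α) + σ * e) / √D| ≤ y * Q := by
    rw [abs_div, abs_of_pos hD, div_eq_mul_one_div]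
    gcongr
  have t2 : |α * (v - u) * ((α - 1) * y ^ (α - 2) * y') * ((y ^ (1 + α) + σ * e) / √D)| ≤
      5 / 4 * K * (y ^ (α - 1) * Q) := by
    rw [abs_mul, abs_mul (α * (v - u)), abs_mul _ y', abs_mul (α - 1), abs_of_nonneg hαv0,
      abs_of_pos hyp2']
    have ha : |α - 1| ≤ 1 := abs_le.2 ⟨by linarith, by linarith⟩
    calc _ ≤ 5 / 4 * (1 * y ^ (α - 2) * K) * (y * Q) := by gcongr
      _ = 5 / 4 * K * ((y ^ (α - 2) * y) * Q) := by ring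
      _ = _ := by rw [hyp2]
  have t3 : |α * (v' - u') * y ^ (α - 1) * ((y ^ (1 + α) + σ * e) / √D)| ≤
      5 / 2 * K * (y ^ (α - 1) * Q) := by
    rw [abs_mul, abs_mul, abs_mul, abs_of_pos hα0, abs_of_pos hyp]
    calc _ ≤ 1 * (2 * K) * y ^ (α - 1) * (5 / 4 * Q) := by
          gcongr
          exact hU.trans (mul_le_mul_of_nonneg_right (by linarith) hQ0)
      _ = _ := by ring
  rw [add_mul (α * (v - u) * ((α - 1) * y ^ (α - 2) * y'))]
  calc _ ≤ 5 / 4 * y ^ (α - 1) * ((4 + 22 * K) / discrConst α * Q) +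
        (5 / 4 * K * (y ^ (α - 1) * Q) + 5 / 2 * K * (y ^ (α - 1) * Q)) :=
      (abs_add_le _ _).trans (add_le_add t1 ((abs_add_le _ _).trans (add_le_add t2 t3)))
    _ = _ := by rw [hQ]; ring

end bounds

/-! ### Differentiation under the integral sign -/

theorem div_sqrt_mul (p w : ℝ) {y : ℝ} (hy : 0 ≤ y) : p / √(y * w) = p * (1 / √y) * (1 / √w) := by
  rw [Real.sqrt_mul hy, mul_assoc, one_div_mul_one_div, div_eq_mul_one_div]

theorem integrableOn_one_div_sqrt_mul_one_sub :
    IntegrableOn (fun x : ℝ => 1 / √(x * (1 - x))) (Ioo 0 1) := by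
  have h1 : IntervalIntegrable (fun x : ℝ => x ^ (-(1 / 2) : ℝ)) volume 0 1 :=
    intervalIntegral.intervalIntegrable_rpow' (by norm_num)
  have h2 : IntervalIntegrable (fun x : ℝ => (1 - x) ^ (-(1 / 2) : ℝ)) volume 0 1 := by
    simpa using (h1.comp_sub_left 1).symm
  have h3 := ((h1.add h2).1.mono_set Ioo_subset_Ioc_self)
  refine Integrable.mono' h3 (Measurable.aestronglyMeasurable (by fun_prop)) ?_
  refine (ae_restrict_iff' measurableSet_Ioo).2 (Eventually.of_forall fun x hx => ?_)
  have hx0 := hx.1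
  have hx1 := sub_pos.2 hx.2
  have e : 1 / (x * (1 - x)) = 1 / x + 1 / (1 - x) := by field_simp; ring
  have hs : ∀ y : ℝ, 0 < y → y ^ (-(1 / 2) : ℝ) = √(1 / y) := fun y hy => by
    rw [Real.sqrt_eq_rpow, one_div y, Real.inv_rpow hy.le, Real.rpow_neg hy.le]
  rw [Real.norm_of_nonneg (by positivity)]
  have e' : 1 / √(x * (1 - x)) = √(1 / (x * (1 - x))) := by
    rw [Real.sqrt_div zero_le_one, Real.sqrt_one]
  rw [hs x hx0, hs _ hx1, e', e]
  have ha : 0 ≤ 1 / x := by positivity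
  have hb : 0 ≤ 1 / (1 - x) := by positivity
  rw [Real.sqrt_le_left (by positivity), add_sq, Real.sq_sqrt ha, Real.sq_sqrt hb]
  have : 0 ≤ 2 * √(1 / x) * √(1 / (1 - x)) := by positivity
  linarith

theorem measurable_axialDensity (α τ u v : ℝ) : Measurable (axialDensity α τ u v) := by
  unfold axialDensity discr
  fun_prop

theorem measurable_axialDensityDeriv (α σ e u v u' v' : ℝ) :
    Measurable (axialDensityDeriv α σ e u v u' v') := by
  unfold axialDensityDeriv transportDefect discr
  fun_prop

section

variable {α σ δ K : ℝ} {u v u' v' : ℝ → ℝ}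

theorem IsRootPair.hasDerivAt_axialDensity (h : IsRootPair α σ δ K u v u' v') (hα : 0 < α)
    (hα1 : α ≤ 1) (hσ : σ = 1 ∨ σ = -1) {e x : ℝ} (he : e ∈ Ioo 0 δ) (hx : x ∈ Ioo (0 : ℝ) 1) :
    HasDerivAt (fun e => axialDensity α (σ * e) (u e) (v e) x)
      (axialDensityDeriv α σ e (u e) (v e) (u' e) (v' e) x) e := by
  have hr := h.isRoots hα hα1 hσ he
  have hy := hr.u_pos.trans_le (hr.mem_Icc (Ioo_subset_Icc_self hx)).1
  have hD := hr.discr_pos hx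
  have hu := h.u_deriv e he
  have hv := h.v_deriv e he
  have hyd : HasDerivAt (fun e => (1 - x) * u e + x * v e) ((1 - x) * u' e + x * v' e) e :=
    (hu.const_mul (1 - x)).add (hv.const_mul x)
  have hyp := hyd.rpow_const (p := 1 + α) (Or.inl hy.ne')
  have hU := hyp.add ((hasDerivAt_id e).const_mul σ)
  have hDd := (hyd.pow 2).sub (hU.pow 2)
  have hsq := hDd.sqrt (by simpa [discr] using hD.ne')
  have hq := hU.div hsq (by simpa [discr] using (Real.sqrt_pos.2 hD).ne')
  have hpre := (((hv.sub hu).const_mul α).mul (hyd.rpow_const (p := α - 1) (Or.inl hy.ne')))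
  have hall := hpre.mul hq
  unfold axialDensity discr
  refine hall.congr_deriv ?_
  have hs := Real.sqrt_pos.2 hD
  have hs2 := Real.sq_sqrt hD.le
  unfold axialDensityDeriv transportDefect
  simp only [Pi.add_apply, Pi.sub_apply, Pi.pow_apply, Pi.mul_apply, Pi.div_apply, id,
    add_sub_cancel_left, mul_one]
  rw [show α - 1 - 1 = α - 2 by ring]
  have hDdef : discr α (σ * e) ((1 - x) * u e + x * v e) = ((1 - x) * u e + x * v e) ^ 2 -
    (((1 - x) * u e + x * v e) ^ (1 + α) + σ * e) ^ 2 := rfl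
  rw [← hDdef]
  have hsplit : ((1 - x) * u e + x * v e) ^ (1 + α) =
      ((1 - x) * u e + x * v e) * ((1 - x) * u e + x * v e) ^ α := by
    rw [Real.rpow_add hy, Real.rpow_one]
  rw [hsplit] at hDdef ⊢
  generalize (1 - x) * u e + x * v e = y at *
  generalize (1 - x) * u' e + x * v' e = y' at *
  generalize discr α (σ * e) y = D at *
  generalize y ^ (α - 1) = p1 at *
  generalize y ^ (α - 2) = p2 at *
  generalize y ^ α = p at *
  set s := √D with hs_def
  rw [← hs2] at hDdef ⊢
  norm_num
  field_simp
  linear_combination ((v e - u e) * p1 * (σ + y' * p * (1 + α))) * hDdef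

/-- The half axial displacement of the profile over one period, in the `x`-coordinate. -/
noncomputable def axialIntegral (α τ u v : ℝ) : ℝ := ∫ x in Ioo (0 : ℝ) 1, axialDensity α τ u v x

theorem IsRoots.integrableOn_axialDensity {α σ e u v : ℝ} (h : IsRoots α σ e u v) (hα1 : α ≤ 1) :
    IntegrableOn (axialDensity α (σ * e) u v) (Ioo 0 1) := by
  refine Integrable.mono' (integrableOn_one_div_sqrt_mul_one_sub.const_mul
    (5 / 4 * (1 / √(discrConst α)) * ((5 / 4) ^ α * (1 / √u))))
    (measurable_axialDensity _ _ _ _).aestronglyMeasurable ?_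
  refine (ae_restrict_iff' measurableSet_Ioo).2 (Eventually.of_forall fun x hx => ?_)
  refine (h.abs_axialDensity_le hα1 hx).trans ?_
  have hm := h.mem_Icc (Ioo_subset_Icc_self hx)
  have hu := h.u_pos
  have hα := h.α_pos
  have hy := hu.trans_le hm.1
  have hx0 := hx.1
  have hx1 := sub_pos.2 hx.2
  have hv := h.v_mem.2
  rw [div_sqrt_mul _ _ hy.le, ← mul_assoc]
  have h1 : ((1 - x) * u + x * v) ^ α ≤ (5 / 4) ^ α :=
    Real.rpow_le_rpow hy.le (hm.2.trans hv.le) hα.le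
  have h2 : 1 / √((1 - x) * u + x * v) ≤ 1 / √u :=
    one_div_le_one_div_of_le (Real.sqrt_pos.2 hu) (Real.sqrt_le_sqrt hm.1)
  gcongr

theorem IsRootPair.hasDerivAt_axialIntegral (h : IsRootPair α σ δ K u v u' v') (hα : 0 < α)
    (hα1 : α ≤ 1) (hσ : σ = 1 ∨ σ = -1) {e₀ : ℝ} (he₀ : e₀ ∈ Ioo 0 δ) :
    IntegrableOn (axialDensityDeriv α σ e₀ (u e₀) (v e₀) (u' e₀) (v' e₀)) (Ioo 0 1) ∧
    HasDerivAt (fun e => axialIntegral α (σ * e) (u e) (v e))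
      (∫ x in Ioo (0 : ℝ) 1, axialDensityDeriv α σ e₀ (u e₀) (v e₀) (u' e₀) (v' e₀) x) e₀ := by
  have hs : Ioo (e₀ / 2) δ ∈ 𝓝 e₀ := Ioo_mem_nhds (by linarith [he₀.1]) he₀.2
  have hsub : ∀ e ∈ Ioo (e₀ / 2) δ, e ∈ Ioo 0 δ := fun e he =>
    ⟨by linarith [he₀.1, he.1], he.2⟩
  have hpos : 0 < e₀ / 4 := by linarith [he₀.1]
  set C := (5 / 4 * ((4 + 22 * K) / discrConst α) + 15 / 4 * K) * (1 / √(discrConst α)) with hC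
  have hC0 : 0 ≤ C := by
    have := (h.isRoots hα hα1 hσ he₀).discrConst_pos
    have := h.K_pos
    positivity
  refine hasDerivAt_integral_of_dominated_loc_of_deriv_le (μ := volume.restrict (Ioo (0 : ℝ) 1))
    (F := fun e x => axialDensity α (σ * e) (u e) (v e) x)
    (F' := fun e x => axialDensityDeriv α σ e (u e) (v e) (u' e) (v' e) x)
    (bound := fun x => C * ((e₀ / 4) ^ (α - 1) * (1 / √(e₀ / 4))) * (1 / √(x * (1 - x)))) hs
    (Eventually.of_forall fun e => (measurable_axialDensity _ _ _ _).aestronglyMeasurable)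
    ((h.isRoots hα hα1 hσ he₀).integrableOn_axialDensity hα1)
    (measurable_axialDensityDeriv _ _ _ _ _ _ _).aestronglyMeasurable ?_
    (integrableOn_one_div_sqrt_mul_one_sub.const_mul _) ?_
  · refine (ae_restrict_iff' measurableSet_Ioo).2 (Eventually.of_forall fun x hx e he => ?_)
    have hm := h.isMovingRoots hα hα1 hσ (hsub e he)
    refine (hm.abs_axialDensityDeriv_le hx).trans ?_
    have hy := (hm.mem_Icc (Ioo_subset_Icc_self hx)).1
    have hy1 : e₀ / 4 ≤ (1 - x) * u e + x * v e := by
      linarith [h.u_lower e (hsub e he), he.1]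
    have hy0 := hpos.trans_le hy1
    rw [div_sqrt_mul _ _ hy0.le, ← mul_assoc, ← hC]
    have h1 : ((1 - x) * u e + x * v e) ^ (α - 1) ≤ (e₀ / 4) ^ (α - 1) :=
      Real.rpow_le_rpow_of_nonpos hpos hy1 (by linarith)
    have h2 : 1 / √((1 - x) * u e + x * v e) ≤ 1 / √(e₀ / 4) :=
      one_div_le_one_div_of_le (Real.sqrt_pos.2 hpos) (Real.sqrt_le_sqrt hy1)
    gcongr
  · exact (ae_restrict_iff' measurableSet_Ioo).2 (Eventually.of_forall fun x hx e he =>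
      h.hasDerivAt_axialDensity hα hα1 hσ (hsub e he) hx)

end

/-! ### The neck limit -/

/-- The limit of `e ^ (2 - α) * axialDensityDeriv` at `x = e ξ`, up to the sign `σ`. -/
noncomputable def neckDensity (α ξ : ℝ) : ℝ :=
  α * (1 + ξ) ^ (α - 1) * ((1 + ξ) / (2 + ξ) / √(ξ * (2 + ξ))) +
    α * ((α - 1) * (1 + ξ) ^ (α - 2)) * (1 / √(ξ * (2 + ξ)))

/-- The integrand `1 / √(r ^ (2n-2) - 1)` of the catenoid constant in the coordinate
`ξ = r ^ (n-1) - 1`. -/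
noncomputable def catenoidDensity (α ξ : ℝ) : ℝ := α * (1 + ξ) ^ (α - 1) / √(ξ * (2 + ξ))

theorem integrableOn_one_div_one_add_mul_sqrt :
    IntegrableOn (fun ξ : ℝ => 1 / ((1 + ξ) * √ξ)) (Ioi 0) := by
  have hlim : Tendsto (fun ξ : ℝ => 2 * Real.arctan (√ξ)) atTop (𝓝 (2 * (Real.pi / 2))) :=
    ((Real.tendsto_arctan_atTop.mono_right nhdsWithin_le_nhds).comp
      Real.tendsto_sqrt_atTop).const_mul 2
  refine integrableOn_Ioi_deriv_of_nonneg (g := fun ξ : ℝ => 2 * Real.arctan (√ξ))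
    (by fun_prop) ?_ ?_ hlim
  · intro ξ hξ
    rw [mem_Ioi] at hξ
    have h := ((Real.hasDerivAt_sqrt hξ.ne').arctan).const_mul 2
    refine h.congr_deriv ?_
    have := Real.sqrt_pos.2 hξ
    rw [Real.sq_sqrt hξ.le]
    field_simp
  · intro ξ hξ
    rw [mem_Ioi] at hξ
    positivity

theorem rpow_div_sqrt_le {α ξ : ℝ} (hα : α ≤ 1 / 2) (hξ : 0 < ξ) :
    (1 + ξ) ^ (α - 1) / √(ξ * (1 + ξ)) ≤ 1 / ((1 + ξ) * √ξ) := by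
  have h1 : (1 + ξ) ^ (α - 1) ≤ 1 / √(1 + ξ) := by
    rw [one_div, Real.sqrt_eq_rpow, ← Real.rpow_neg (by linarith)]
    exact Real.rpow_le_rpow_of_exponent_le (by linarith) (by linarith)
  have h2 := Real.sqrt_pos.2 hξ
  have h3 := Real.sqrt_pos.2 (show 0 < 1 + ξ by linarith)
  rw [Real.sqrt_mul hξ.le]
  calc (1 + ξ) ^ (α - 1) / (√ξ * √(1 + ξ)) ≤ 1 / √(1 + ξ) / (√ξ * √(1 + ξ)) := by gcongr
    _ = 1 / (√(1 + ξ) ^ 2 * √ξ) := by field_simp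
    _ = _ := by rw [Real.sq_sqrt (by linarith)]

theorem rpow_div_sqrt_le' {α ξ : ℝ} (hα : α ≤ 1 / 2) (hξ : 0 < ξ) :
    (1 + ξ) ^ (α - 1) / √(ξ * (2 + ξ)) ≤ 1 / ((1 + ξ) * √ξ) := by
  refine le_trans ?_ (rpow_div_sqrt_le hα hξ)
  gcongr
  norm_num

theorem integrableOn_catenoidDensity {α : ℝ} (hα : 0 < α) (hα2 : α ≤ 1 / 2) :
    IntegrableOn (catenoidDensity α) (Ioi 0) := by
  refine Integrable.mono' (integrableOn_one_div_one_add_mul_sqrt.const_mul α)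
    (Measurable.aestronglyMeasurable (by unfold catenoidDensity; fun_prop)) ?_
  refine (ae_restrict_iff' measurableSet_Ioi).2 (Eventually.of_forall fun ξ hξ => ?_)
  rw [mem_Ioi] at hξ
  unfold catenoidDensity
  rw [Real.norm_of_nonneg (by positivity), mul_div_assoc]
  exact mul_le_mul_of_nonneg_left (rpow_div_sqrt_le' hα2 hξ) hα.le

theorem integrableOn_neckDensity {α : ℝ} (hα : 0 < α) (hα2 : α ≤ 1 / 2) :
    IntegrableOn (neckDensity α) (Ioi 0) := by
  refine Integrable.mono' (integrableOn_one_div_one_add_mul_sqrt.const_mul 2)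
    (Measurable.aestronglyMeasurable (by unfold neckDensity; fun_prop)) ?_
  refine (ae_restrict_iff' measurableSet_Ioi).2 (Eventually.of_forall fun ξ hξ => ?_)
  rw [mem_Ioi] at hξ
  refine le_trans ?_ (mul_le_mul_of_nonneg_left (rpow_div_sqrt_le' hα2 hξ) zero_le_two)
  have hs := Real.sqrt_pos.2 (show 0 < ξ * (2 + ξ) by positivity)
  have h2 : (1 + ξ) ^ (α - 2) ≤ (1 + ξ) ^ (α - 1) :=
    Real.rpow_le_rpow_of_exponent_le (by linarith) (by linarith)
  have hp : 0 < (1 + ξ) ^ (α - 2) := by positivity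
  have hp1 : 0 < (1 + ξ) ^ (α - 1) := by positivity
  have h3 : (1 + ξ) / (2 + ξ) ≤ 1 := by rw [div_le_one (by linarith)]; linarith
  have h30 : 0 ≤ (1 + ξ) / (2 + ξ) := by positivity
  have e : neckDensity α ξ = (α * (1 + ξ) ^ (α - 1) * ((1 + ξ) / (2 + ξ)) +
      α * (α - 1) * (1 + ξ) ^ (α - 2)) / √(ξ * (2 + ξ)) := by
    unfold neckDensity; ring
  rw [e, norm_div, Real.norm_of_nonneg hs.le, ← mul_div_assoc (2 : ℝ)]
  refine div_le_div_of_nonneg_right ?_ hs.le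
  rw [Real.norm_eq_abs, abs_le]
  constructor
  · have : α * (1 - α) * (1 + ξ) ^ (α - 2) ≤ 1 * (1 + ξ) ^ (α - 1) :=
      mul_le_mul (by nlinarith) h2 hp.le zero_le_one
    have : 0 ≤ α * (1 + ξ) ^ (α - 1) * ((1 + ξ) / (2 + ξ)) := by positivity
    linarith
  · have h4 : α * (1 + ξ) ^ (α - 1) * ((1 + ξ) / (2 + ξ)) ≤ 1 * (1 + ξ) ^ (α - 1) * 1 := by
      gcongr; linarith
    have h5 : 0 ≤ α * (1 - α) * (1 + ξ) ^ (α - 2) :=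
      mul_nonneg (mul_nonneg hα.le (by linarith)) hp.le
    linarith

/-- `neckDensity α - α * catenoidDensity α` is the derivative of a function that vanishes at both
ends of `(0, ∞)`. -/
theorem integral_neckDensity {α : ℝ} (hα : 0 < α) (hα2 : α ≤ 1 / 2) :
    ∫ ξ in Ioi 0, neckDensity α ξ = α * ∫ ξ in Ioi 0, catenoidDensity α ξ := by
  have hJ := integrableOn_neckDensity hα hα2
  have hA := (integrableOn_catenoidDensity hα hα2).const_mul α
  set G : ℝ → ℝ := fun ξ => -α * (√ξ * (1 + ξ) ^ (α - 1) / √(2 + ξ)) with hG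
  have hcont : ContinuousWithinAt G (Ici 0) 0 := by
    refine ContinuousAt.continuousWithinAt ?_
    refine continuousAt_const.mul (((Real.continuous_sqrt.continuousAt).mul ?_).div ?_ (by simp))
    · exact ContinuousAt.rpow_const (by fun_prop) (Or.inl (by norm_num))
    · fun_prop
  have hlim : Tendsto G atTop (𝓝 0) := by
    have h1 : Tendsto (fun ξ : ℝ => (1 + ξ) ^ (α - 1)) atTop (𝓝 0) := by
      have := (tendsto_rpow_neg_atTop (show 0 < 1 - α by linarith)).comp
        (tendsto_atTop_add_const_left atTop (1 : ℝ) tendsto_id)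
      refine this.congr fun ξ => ?_
      simp
    have h2 : Tendsto (fun ξ : ℝ => √ξ * (1 + ξ) ^ (α - 1) / √(2 + ξ)) atTop (𝓝 0) := by
      refine squeeze_zero' ?_ ?_ h1
      · filter_upwards [eventually_ge_atTop 0] with ξ hξ
        positivity
      · filter_upwards [eventually_ge_atTop 0] with ξ hξ
        rw [div_le_iff₀ (Real.sqrt_pos.2 (by linarith)), mul_comm]
        exact mul_le_mul_of_nonneg_left (Real.sqrt_le_sqrt (by linarith)) (by positivity)
    simpa [hG] using h2.const_mul (-α)
  have hder : ∀ ξ ∈ Ioi (0 : ℝ), HasDerivAt G (neckDensity α ξ - α * catenoidDensity α ξ) ξ := by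
    intro ξ hξ
    rw [mem_Ioi] at hξ
    have h1 : (0 : ℝ) < 1 + ξ := by linarith
    have h2 : (0 : ℝ) < 2 + ξ := by linarith
    have d1 := Real.hasDerivAt_sqrt hξ.ne'
    have d2 := ((hasDerivAt_id ξ).const_add 1).rpow_const (p := α - 1) (Or.inl h1.ne')
    have d3 := ((hasDerivAt_id ξ).const_add 2).sqrt h2.ne'
    have d := ((d1.mul d2).div d3 (Real.sqrt_pos.2 h2).ne').const_mul (-α)
    refine d.congr_deriv ?_
    simp only [id, Pi.mul_apply]
    have s1 := Real.sqrt_pos.2 hξ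
    have s2 := Real.sqrt_pos.2 h2
    have q1 := Real.sq_sqrt hξ.le
    have q2 := Real.sq_sqrt h2.le
    unfold neckDensity catenoidDensity
    rw [show α - 1 - 1 = α - 2 by ring, Real.sqrt_mul hξ.le]
    have hp : (1 + ξ) ^ (α - 1) = (1 + ξ) ^ (α - 2) * (1 + ξ) := by
      rw [← Real.rpow_add_one h1.ne']; congr 1; ring
    rw [hp]
    generalize (1 + ξ) ^ (α - 2) = p
    generalize √ξ = a at *
    generalize √(2 + ξ) = b at *
    have hb : b ^ 2 = 2 + a ^ 2 := by rw [q2, q1]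
    rw [← q1]
    have : (2 + a ^ 2) ≠ 0 := by positivity
    field_simp
    rw [show b ^ 2 = 2 + a ^ 2 from hb]
    ring
  have h := integral_Ioi_of_hasDerivAt_of_tendsto hcont hder (hJ.sub hA) hlim
  have hG0 : G 0 = 0 := by simp [hG]
  rw [hG0, sub_zero, integral_sub hJ hA, integral_const_mul] at h
  linarith

/-- The scaling of the derivative in the neck region, in terms of `Y = y / e`; the powers `y ^ α`
are the terms that disappear in the limit. -/
theorem axialDensityDeriv_scaled {α σ e u v u' v' x : ℝ} (he : 0 < e)
    (hy : 0 < (1 - x) * u + x * v) (hD : 0 < discr α (σ * e) ((1 - x) * u + x * v)) {y y' Y D : ℝ}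
    (hy_def : y = (1 - x) * u + x * v) (hy'_def : y' = (1 - x) * u' + x * v')
    (hY_def : Y = y / e) (hD_def : D = Y ^ 2 - (Y * y ^ α + σ) ^ 2) :
    e ^ (2 - α) * axialDensityDeriv α σ e u v u' v' x =
      α * (v - u) * Y ^ (α - 1) * (Y * (σ * Y + α * (Y * y ^ α) * y' - σ * y') / D / √D) +
      (α * (v - u) * ((α - 1) * Y ^ (α - 2) * y') + α * (e * (v' - u')) * Y ^ (α - 1)) *
        ((Y * y ^ α + σ) / √D) := by
  unfold axialDensityDeriv transportDefect
  rw [← hy_def] at hy hD ⊢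
  rw [← hy'_def]
  have hy1 : y = e * Y := by rw [hY_def]; field_simp
  have hY : 0 < Y := by rw [hY_def]; positivity
  have hyp : y ^ (1 + α) = e * (Y * y ^ α) := by
    rw [Real.rpow_add hy, Real.rpow_one, ← mul_assoc, ← hy1]
  have hdis : discr α (σ * e) y = e ^ 2 * D := by
    rw [discr, hyp, hD_def]
    nth_rewrite 1 [hy1]
    ring
  have hD0 : 0 < D := by
    rw [hdis] at hD
    exact pos_of_mul_pos_right hD (sq_nonneg e)
  have hsq : √(discr α (σ * e) y) = e * √D := by
    rw [hdis, Real.sqrt_mul (sq_nonneg e), Real.sqrt_sq he.le]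
  have hE : e ^ (α - 1) = e * e ^ (α - 2) := by
    rw [mul_comm, ← Real.rpow_add_one he.ne']; congr 1; ring
  have hE2 : e ^ (2 - α) = (e ^ (α - 2))⁻¹ := by
    rw [← Real.rpow_neg he.le]; congr 1; ring
  have hEp : 0 < e ^ (α - 2) := by positivity
  have hp1 : y ^ (α - 1) = e * e ^ (α - 2) * Y ^ (α - 1) := by
    rw [hy1, Real.mul_rpow he.le hY.le, hE]
  have hp2 : y ^ (α - 2) = e ^ (α - 2) * Y ^ (α - 2) := by
    rw [hy1, Real.mul_rpow he.le hY.le]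
  have hs := Real.sqrt_pos.2 hD0
  rw [hsq, hdis, hp1, hp2, hE2, hyp]
  generalize y ^ α = p at *
  generalize e ^ (α - 2) = E at *
  rw [hy1]
  field_simp

section

variable {α σ δ K : ℝ} {u v u' v' : ℝ → ℝ}

theorem IsRootPair.tendsto_scaled_axialDensityDeriv (h : IsRootPair α σ δ K u v u' v')
    (hα : 0 < α) (hα1 : α ≤ 1) (hσ : σ = 1 ∨ σ = -1) {ξ : ℝ} (hξ : 0 < ξ) :
    Tendsto (fun e => e ^ (2 - α) *
      axialDensityDeriv α σ e (u e) (v e) (u' e) (v' e) (e * ξ)) (𝓝[>] 0)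
      (𝓝 (σ * neckDensity α ξ)) := by
  have hσ2 : σ ^ 2 = 1 := by rcases hσ with hs | hs <;> rw [hs] <;> norm_num
  have hid : Tendsto (fun e : ℝ => e) (𝓝[>] 0) (𝓝 0) := tendsto_id.mono_left nhdsWithin_le_nhds
  have hx : Tendsto (fun e : ℝ => e * ξ) (𝓝[>] 0) (𝓝 0) := by simpa using hid.mul_const ξ
  have hx1 : Tendsto (fun e : ℝ => 1 - e * ξ) (𝓝[>] 0) (𝓝 1) := by simpa using hx.const_sub 1
  have hpos : ∀ᶠ e : ℝ in 𝓝[>] 0, 0 < e := self_mem_nhdsWithin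
  obtain ⟨c, hc⟩ := h.v'_lim
  have hu : Tendsto u (𝓝[>] 0) (𝓝 0) := by
    have := h.u_div.mul hid
    simp only [mul_zero] at this
    refine this.congr' (hpos.mono fun e he => ?_)
    field_simp
  have hY : Tendsto (fun e => ((1 - e * ξ) * u e + e * ξ * v e) / e) (𝓝[>] 0) (𝓝 (1 + ξ)) := by
    have := (hx1.mul h.u_div).add (h.v_lim.const_mul ξ)
    simp only [mul_one] at this
    refine this.congr' (hpos.mono fun e he => ?_)
    field_simp
  have hy : Tendsto (fun e => (1 - e * ξ) * u e + e * ξ * v e) (𝓝[>] 0) (𝓝 0) := by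
    simpa using (hx1.mul hu).add (hx.mul h.v_lim)
  have hyα : Tendsto (fun e => ((1 - e * ξ) * u e + e * ξ * v e) ^ α) (𝓝[>] 0) (𝓝 0) := by
    simpa [Real.zero_rpow hα.ne'] using hy.rpow_const (p := α) (Or.inr hα.le)
  have hy' : Tendsto (fun e => (1 - e * ξ) * u' e + e * ξ * v' e) (𝓝[>] 0) (𝓝 1) := by
    simpa using (hx1.mul h.u'_lim).add (hx.mul hc)
  have hvu : Tendsto (fun e => v e - u e) (𝓝[>] 0) (𝓝 1) := by simpa using h.v_lim.sub hu
  have hvu' : Tendsto (fun e => e * (v' e - u' e)) (𝓝[>] 0) (𝓝 0) := by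
    simpa using hid.mul (hc.sub h.u'_lim)
  have hYp := hY.mul hyα
  rw [mul_zero] at hYp
  have hU := hYp.add_const σ
  rw [zero_add] at hU
  have hD := (hY.pow 2).sub (hU.pow 2)
  have hDe : (1 + ξ) ^ 2 - σ ^ 2 = ξ * (2 + ξ) := by rw [hσ2]; ring
  rw [hDe] at hD
  have hD0 : 0 < ξ * (2 + ξ) := by positivity
  have hs0 := Real.sqrt_pos.2 hD0
  have hY1 := hY.rpow_const (p := α - 1) (Or.inl (show 1 + ξ ≠ 0 by positivity))
  have hY2 := hY.rpow_const (p := α - 2) (Or.inl (show 1 + ξ ≠ 0 by positivity))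
  have hΨ := ((hY.const_mul σ).add ((hYp.const_mul α).mul hy')).sub (hy'.const_mul σ)
  have t1 := ((hvu.const_mul α).mul hY1).mul
    (((hY.mul hΨ).div hD hD0.ne').div hD.sqrt hs0.ne')
  have t2 := (((hvu.const_mul α).mul ((hY2.const_mul (α - 1)).mul hy')).add
    ((hvu'.const_mul α).mul hY1)).mul (hU.div hD.sqrt hs0.ne')
  have t := t1.add t2
  have hlim : α * 1 * (1 + ξ) ^ (α - 1) * ((1 + ξ) * (σ * (1 + ξ) + α * 0 * 1 - σ * 1) /
      (ξ * (2 + ξ)) / √(ξ * (2 + ξ))) + (α * 1 * ((α - 1) * (1 + ξ) ^ (α - 2) * 1) +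
      α * 0 * (1 + ξ) ^ (α - 1)) * (σ / √(ξ * (2 + ξ))) = σ * neckDensity α ξ := by
    unfold neckDensity
    field_simp
    ring
  rw [hlim] at t
  refine t.congr' ?_
  filter_upwards [hpos, nhdsWithin_le_nhds (Iio_mem_nhds h.δ_pos),
    hx.eventually (gt_mem_nhds one_pos)] with e he heδ hx1
  have hr := h.isRoots hα hα1 hσ ⟨he, heδ⟩
  have hxm : e * ξ ∈ Ioo (0 : ℝ) 1 := ⟨by positivity, hx1⟩
  exact (axialDensityDeriv_scaled he
    (hr.u_pos.trans_le (hr.mem_Icc (Ioo_subset_Icc_self hxm)).1)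
    (hr.discr_pos hxm) rfl rfl rfl rfl).symm

/-- In the neck half of the interval, the scaled derivative is dominated uniformly in `e`. -/
theorem IsRootPair.abs_scaled_axialDensityDeriv_le (h : IsRootPair α σ δ K u v u' v')
    (hα : 0 < α) (hα2 : α ≤ 1 / 2) (hσ : σ = 1 ∨ σ = -1) {e ξ : ℝ} (he : e ∈ Ioo 0 δ)
    (hξ : 0 < ξ) (hx : e * ξ ≤ 1 / 2) :
    |e ^ (2 - α) * axialDensityDeriv α σ e (u e) (v e) (u' e) (v' e) (e * ξ)| ≤
      ((5 / 4 * ((4 + 22 * K) / discrConst α) + 15 / 4 * K) * (1 / √(discrConst α))) *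
      ((1 / 4) ^ (α - 1) * √8) * (1 / ((1 + ξ) * √ξ)) := by
  have he0 := he.1
  have hx0 : 0 < e * ξ := by positivity
  have hm := h.isMovingRoots hα (by linarith) hσ he
  have hb := hm.abs_axialDensityDeriv_le ⟨hx0, by linarith⟩
  set C := (5 / 4 * ((4 + 22 * K) / discrConst α) + 15 / 4 * K) * (1 / √(discrConst α)) with hC
  have hC0 : 0 ≤ C := by
    have := hm.discrConst_pos
    have := h.K_pos
    positivity
  set y := (1 - e * ξ) * u e + e * ξ * v e with hy_def
  have hy : e * (1 / 4 * (1 + ξ)) ≤ y := by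
    have h1 := h.u_lower e he
    have h2 := (h.v_mem e he).1
    rw [hy_def]
    nlinarith
  have hy0 : 0 < e * (1 / 4 * (1 + ξ)) := by positivity
  have hEp : 0 < e ^ (2 - α) := by positivity
  rw [abs_mul, abs_of_pos hEp]
  have h1 : y ^ (α - 1) ≤ e ^ (α - 1) * ((1 / 4) ^ (α - 1) * (1 + ξ) ^ (α - 1)) := by
    rw [← Real.mul_rpow (by norm_num) (by linarith), ← Real.mul_rpow he0.le (by positivity)]
    exact Real.rpow_le_rpow_of_nonpos hy0 hy (by linarith)
  have h2 : e * √(ξ * (1 + ξ)) / √8 ≤ √(y * (e * ξ * (1 - e * ξ))) := by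
    rw [div_le_iff₀ (by positivity), ← Real.sqrt_mul (by
      have := hy0.trans_le hy
      have : 0 ≤ 1 - e * ξ := by linarith
      positivity)]
    apply Real.le_sqrt_of_sq_le
    rw [mul_pow, Real.sq_sqrt (by positivity)]
    have : e * (1 / 4 * (1 + ξ)) * (e * ξ * (1 / 2)) ≤ y * (e * ξ * (1 - e * ξ)) := by
      gcongr <;> linarith
    linarith
  have hs : 0 < √(ξ * (1 + ξ)) := Real.sqrt_pos.2 (by positivity)
  have hE : e ^ (2 - α) * e ^ (α - 1) = e := by
    rw [← Real.rpow_add he0]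
    norm_num
  calc e ^ (2 - α) * |axialDensityDeriv α σ e (u e) (v e) (u' e) (v' e) (e * ξ)|
      ≤ e ^ (2 - α) * (C * (e ^ (α - 1) * ((1 / 4) ^ (α - 1) * (1 + ξ) ^ (α - 1)) /
        (e * √(ξ * (1 + ξ)) / √8))) := by
        refine mul_le_mul_of_nonneg_left (hb.trans (mul_le_mul_of_nonneg_left ?_ hC0)) hEp.le
        exact div_le_div₀ (by positivity) h1 (by positivity) h2
    _ = C * ((1 / 4) ^ (α - 1) * √8) * ((1 + ξ) ^ (α - 1) / √(ξ * (1 + ξ))) *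
        (e ^ (2 - α) * e ^ (α - 1) / e) := by
        field_simp
    _ = C * ((1 / 4) ^ (α - 1) * √8) * ((1 + ξ) ^ (α - 1) / √(ξ * (1 + ξ))) := by
        rw [hE, div_self he0.ne', mul_one]
    _ ≤ _ := mul_le_mul_of_nonneg_left (rpow_div_sqrt_le hα2 hξ) (by positivity)

theorem IsRootPair.tendsto_neck_integral (h : IsRootPair α σ δ K u v u' v')
    (hα : 0 < α) (hα2 : α ≤ 1 / 2) (hσ : σ = 1 ∨ σ = -1) :
    Tendsto (fun e => e ^ (1 - α) *
      ∫ x in Ioc (0 : ℝ) (1 / 2), axialDensityDeriv α σ e (u e) (v e) (u' e) (v' e) x) (𝓝[>] 0)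
      (𝓝 (∫ ξ in Ioi 0, σ * neckDensity α ξ)) := by
  have hpos : ∀ᶠ e : ℝ in 𝓝[>] 0, e ∈ Ioo 0 δ := Ioo_mem_nhdsGT h.δ_pos
  have hrw : ∀ e ∈ Ioo 0 δ, ∫ ξ in Ioi (0 : ℝ), e ^ (2 - α) * (Iic (1 / 2)).indicator
      (axialDensityDeriv α σ e (u e) (v e) (u' e) (v' e)) (e * ξ) = e ^ (1 - α) *
      ∫ x in Ioc (0 : ℝ) (1 / 2), axialDensityDeriv α σ e (u e) (v e) (u' e) (v' e) x := by
    intro e he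
    have he0 := he.1
    rw [integral_const_mul, integral_comp_mul_left_Ioi _ _ he0, mul_zero,
      setIntegral_indicator measurableSet_Iic, Ioi_inter_Iic, smul_eq_mul, ← mul_assoc]
    congr 1
    rw [← Real.rpow_neg_one, ← Real.rpow_add he0]
    congr 1; ring
  refine Tendsto.congr' (hpos.mono fun e he => hrw e he) ?_
  refine tendsto_integral_filter_of_dominated_convergence
    (fun ξ => ((5 / 4 * ((4 + 22 * K) / discrConst α) + 15 / 4 * K) * (1 / √(discrConst α))) *
      ((1 / 4) ^ (α - 1) * √8) * (1 / ((1 + ξ) * √ξ))) ?_ ?_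
    (integrableOn_one_div_one_add_mul_sqrt.const_mul _) ?_
  · refine Eventually.of_forall fun e => Measurable.aestronglyMeasurable ?_
    exact (((measurable_axialDensityDeriv _ _ _ _ _ _ _).indicator measurableSet_Iic).comp
      (measurable_const_mul e)).const_mul _
  · refine hpos.mono fun e he => ?_
    refine (ae_restrict_iff' measurableSet_Ioi).2 (Eventually.of_forall fun ξ hξ => ?_)
    rw [mem_Ioi] at hξ
    by_cases hx : e * ξ ≤ 1 / 2
    · rw [indicator_of_mem (mem_Iic.2 hx), Real.norm_eq_abs]
      exact h.abs_scaled_axialDensityDeriv_le hα hα2 hσ he hξ hx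
    · rw [indicator_of_notMem (by simpa using hx), mul_zero, norm_zero]
      have := (h.isRoots hα (by linarith) hσ he).discrConst_pos
      have := h.K_pos
      positivity
  · refine (ae_restrict_iff' measurableSet_Ioi).2 (Eventually.of_forall fun ξ hξ => ?_)
    rw [mem_Ioi] at hξ
    have hx : Tendsto (fun e : ℝ => e * ξ) (𝓝[>] 0) (𝓝 0) := by
      have hid : Tendsto (fun e : ℝ => e) (𝓝[>] 0) (𝓝 0) :=
        tendsto_id.mono_left nhdsWithin_le_nhds
      simpa using hid.mul_const ξ
    refine (h.tendsto_scaled_axialDensityDeriv hα (by linarith) hσ hξ).congr' ?_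
    filter_upwards [hx.eventually (gt_mem_nhds (show (0 : ℝ) < 1 / 2 by norm_num))] with e he
    rw [indicator_of_mem (mem_Iic.2 he.le)]

/-- The derivative of the half axial displacement concentrates in the neck. -/
theorem IsRootPair.tendsto_integral_axialDensityDeriv (h : IsRootPair α σ δ K u v u' v')
    (hα : 0 < α) (hα2 : α ≤ 1 / 2) (hσ : σ = 1 ∨ σ = -1) :
    Tendsto (fun e => e ^ (1 - α) *
      ∫ x in Ioo (0 : ℝ) 1, axialDensityDeriv α σ e (u e) (v e) (u' e) (v' e) x) (𝓝[>] 0)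
      (𝓝 (σ * (α * ∫ ξ in Ioi 0, catenoidDensity α ξ))) := by
  have hpos : ∀ᶠ e : ℝ in 𝓝[>] 0, e ∈ Ioo 0 δ := Ioo_mem_nhdsGT h.δ_pos
  have h1 := h.tendsto_neck_integral hα hα2 hσ
  rw [integral_const_mul, integral_neckDensity hα hα2] at h1
  set C := (5 / 4 * ((4 + 22 * K) / discrConst α) + 15 / 4 * K) * (1 / √(discrConst α)) with hC
  set B := ∫ x in Ioo (1 / 2 : ℝ) 1,
    C * ((3 / 8) ^ (α - 1) * (1 / √(3 / 8))) * (1 / √(x * (1 - x))) with hB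
  have hbd : ∀ e ∈ Ioo 0 δ, ‖∫ x in Ioo (1 / 2 : ℝ) 1,
      axialDensityDeriv α σ e (u e) (v e) (u' e) (v' e) x‖ ≤ B := by
    intro e he
    have hm := h.isMovingRoots hα (by linarith) hσ he
    have hC0 : 0 ≤ C := by
      have := hm.discrConst_pos
      have := h.K_pos
      positivity
    refine norm_integral_le_of_norm_le
      ((integrableOn_one_div_sqrt_mul_one_sub.mono_set
        (Ioo_subset_Ioo_left (by norm_num))).const_mul _) ?_
    refine (ae_restrict_iff' measurableSet_Ioo).2 (Eventually.of_forall fun x hx => ?_)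
    have hx0 : x ∈ Ioo (0 : ℝ) 1 := ⟨by linarith [hx.1], hx.2⟩
    refine (hm.abs_axialDensityDeriv_le hx0).trans ?_
    have hy : 3 / 8 ≤ (1 - x) * u e + x * v e := by
      have a1 := hm.v_mem.1
      have a2 := mul_nonneg (sub_nonneg.2 hx.2.le) hm.u_pos.le
      nlinarith [hx.1]
    have hy0 : 0 < (1 - x) * u e + x * v e := by linarith
    rw [div_sqrt_mul _ _ hy0.le, ← mul_assoc, ← hC]
    have a1 : ((1 - x) * u e + x * v e) ^ (α - 1) ≤ (3 / 8) ^ (α - 1) :=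
      Real.rpow_le_rpow_of_nonpos (by norm_num) hy (by linarith)
    have a2 : 1 / √((1 - x) * u e + x * v e) ≤ 1 / √(3 / 8) :=
      one_div_le_one_div_of_le (by positivity) (Real.sqrt_le_sqrt hy)
    gcongr
  have hzero : Tendsto (fun e : ℝ => e ^ (1 - α)) (𝓝[>] 0) (𝓝 0) := by
    have := (Real.continuousAt_rpow_const 0 (1 - α) (Or.inr (by linarith))).tendsto
    rw [Real.zero_rpow (by linarith)] at this
    exact this.mono_left nhdsWithin_le_nhds
  have h2 : Tendsto (fun e => e ^ (1 - α) * ∫ x in Ioo (1 / 2 : ℝ) 1,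
      axialDensityDeriv α σ e (u e) (v e) (u' e) (v' e) x) (𝓝[>] 0) (𝓝 0) := by
    have h3 : Tendsto (fun e : ℝ => e ^ (1 - α) * B) (𝓝[>] 0) (𝓝 0) := by
      simpa using hzero.mul_const B
    refine squeeze_zero_norm' (hpos.mono fun e he => ?_) h3
    rw [norm_mul, Real.norm_of_nonneg (Real.rpow_nonneg he.1.le _)]
    exact mul_le_mul_of_nonneg_left (hbd e he) (Real.rpow_nonneg he.1.le _)
  have h3 := h1.add h2
  rw [add_zero] at h3
  refine h3.congr' (hpos.mono fun e he => ?_)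
  have hint := (h.hasDerivAt_axialIntegral hα (by linarith) hσ he).1
  have hun : Ioc (0 : ℝ) (1 / 2) ∪ Ioo (1 / 2) 1 = Ioo 0 1 :=
    Ioc_union_Ioo_eq_Ioo (by norm_num) (by norm_num)
  change _ = e ^ (1 - α) * _
  rw [← mul_add, ← hun, setIntegral_union _ measurableSet_Ioo]
  · exact hint.mono_set (by rw [← hun]; exact subset_union_left)
  · exact hint.mono_set (by rw [← hun]; exact subset_union_right)
  · exact disjoint_left.2 fun x hx hx' => not_lt.2 hx.2 hx'.1

end

/-! ### The spherical limit of the axial displacement -/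

/-- The axial density of the unit hemisphere, in the coordinate `x = r ^ (n-1)`. -/
noncomputable def sphereDensity (α x : ℝ) : ℝ :=
  α * x ^ (α - 1) * (x ^ (1 + α) / √(discr α 0 x))

theorem discr_zero_pos {α x : ℝ} (hα : 0 < α) (hx : x ∈ Ioo (0 : ℝ) 1) : 0 < discr α 0 x := by
  have h1 : x ^ (1 + α) < x := by
    simpa using Real.rpow_lt_rpow_of_exponent_gt hx.1 hx.2 (show (1 : ℝ) < 1 + α by linarith)
  have h2 : 0 < x ^ (1 + α) := Real.rpow_pos_of_pos hx.1 _
  unfold discr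
  nlinarith [hx.1]

/-- The hemisphere has axial extent `1`: the axial coordinate is `√(1 - r²)`. -/
theorem integral_sphereDensity {α : ℝ} (hα : 0 < α) :
    ∫ x in Ioo (0 : ℝ) 1, sphereDensity α x = 1 := by
  have hcont : ContinuousOn (fun x : ℝ => -√(1 - x ^ (2 * α))) (Icc 0 1) := by
    refine Continuous.continuousOn (Continuous.neg (Real.continuous_sqrt.comp
      (continuous_const.sub (Real.continuous_rpow_const (by positivity)))))
  have hder : ∀ x ∈ Ioo (0 : ℝ) 1,
      HasDerivAt (fun x : ℝ => -√(1 - x ^ (2 * α))) (sphereDensity α x) x := by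
    intro x hx
    have hx0 := hx.1
    have hlt : x ^ (2 * α) < 1 := Real.rpow_lt_one hx.1.le hx.2 (by positivity)
    have hpos : 0 < 1 - x ^ (2 * α) := by linarith
    have d := ((((hasDerivAt_id x).rpow_const (p := 2 * α) (Or.inl hx0.ne')).const_sub 1).sqrt
      hpos.ne').neg
    refine d.congr_deriv ?_
    have h1 : x ^ (1 + α) = x * x ^ α := by rw [Real.rpow_add hx0, Real.rpow_one]
    have h2 : x ^ (2 * α) = x ^ α * x ^ α := by rw [← Real.rpow_add hx0]; congr 1; ring
    have h3 : x ^ (2 * α - 1) = x ^ α * x ^ (α - 1) := by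
      rw [← Real.rpow_add hx0]; congr 1; ring
    have h4 : discr α 0 x = x ^ 2 * (1 - x ^ (2 * α)) := by rw [discr, h1, h2]; ring
    have hs := Real.sqrt_pos.2 hpos
    simp only [id]
    rw [sphereDensity, h4, Real.sqrt_mul (sq_nonneg x), Real.sqrt_sq hx0.le, h1, h3]
    field_simp
  have hint := intervalIntegral.integrableOn_deriv_of_nonneg hcont hder fun x hx => by
    have h1 := hx.1
    unfold sphereDensity
    positivity
  have h := intervalIntegral.integral_eq_sub_of_hasDerivAt_of_le zero_le_one hcont hder
    ((intervalIntegrable_iff_integrableOn_Ioc_of_le zero_le_one).2 hint)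
  rw [intervalIntegral.integral_of_le zero_le_one, integral_Ioc_eq_integral_Ioo] at h
  rw [h]
  simp [Real.zero_rpow (show 2 * α ≠ 0 by positivity)]

/-- Integrability of the dominating function for the spherical limit. -/
theorem integrableOn_rpow_mul_one_div_sqrt {α : ℝ} (hα : 0 < α) :
    IntegrableOn (fun x : ℝ => x ^ (α - 1 / 2) * (1 / √(x * (1 - x)))) (Ioo 0 1) := by
  have h1 : IntegrableOn (fun x : ℝ => x ^ (α - 1)) (Ioo 0 1) :=
    (intervalIntegral.intervalIntegrable_rpow' (a := 0) (b := 1) (by linarith)).1.mono_set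
      Ioo_subset_Ioc_self
  refine Integrable.mono' ((h1.const_mul (√2)).add
    (integrableOn_one_div_sqrt_mul_one_sub.const_mul 2))
    (Measurable.aestronglyMeasurable (by fun_prop)) ?_
  refine (ae_restrict_iff' measurableSet_Ioo).2 (Eventually.of_forall fun x hx => ?_)
  have hx0 := hx.1
  have hx1 := sub_pos.2 hx.2
  have hp : 0 < 1 / √(x * (1 - x)) := by positivity
  have hpα : 0 < x ^ (α - 1 / 2) := by positivity
  rw [Real.norm_of_nonneg (by positivity)]
  simp only [Pi.add_apply]
  rcases le_total x (1 / 2) with hx2 | hx2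
  · have e1 : x ^ (α - 1 / 2) * (1 / √(x * (1 - x))) = x ^ (α - 1) * (1 / √(1 - x)) := by
      have : x ^ (α - 1 / 2) = x ^ (α - 1) * √x := by
        rw [Real.sqrt_eq_rpow, ← Real.rpow_add hx0]; congr 1; ring
      have hs := Real.sqrt_pos.2 hx0
      rw [this, Real.sqrt_mul hx0.le]
      field_simp
    have e2 : 1 / √(1 - x) ≤ √2 := by
      rw [div_le_iff₀ (Real.sqrt_pos.2 hx1), ← Real.sqrt_mul zero_le_two, Real.one_le_sqrt]
      linarith
    rw [e1, mul_comm]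
    have : 0 < x ^ (α - 1) := by positivity
    nlinarith
  · have e1 : x ^ (α - 1 / 2) ≤ 2 := by
      rcases le_total 0 (α - 1 / 2) with h | h
      · linarith [Real.rpow_le_one hx0.le hx.2.le h]
      · calc x ^ (α - 1 / 2) ≤ (1 / 2) ^ (α - 1 / 2) :=
              Real.rpow_le_rpow_of_nonpos (by norm_num) hx2 h
          _ ≤ (1 / 2 : ℝ) ^ (-1 : ℝ) :=
              Real.rpow_le_rpow_of_exponent_ge (by norm_num) (by norm_num) (by linarith)
          _ = 2 := by rw [Real.rpow_neg_one]; norm_num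
    have : 0 < √2 * x ^ (α - 1) := by positivity
    nlinarith

/-- As `e → 0` the half axial displacement tends to that of the unit sphere. -/
theorem IsRootPair.tendsto_axialIntegral {α σ δ K : ℝ} {u v u' v' : ℝ → ℝ}
    (h : IsRootPair α σ δ K u v u' v') (hα : 0 < α) (hα2 : α ≤ 1 / 2) (hσ : σ = 1 ∨ σ = -1) :
    Tendsto (fun e => axialIntegral α (σ * e) (u e) (v e)) (𝓝[>] 0) (𝓝 1) := by
  have hpos : ∀ᶠ e : ℝ in 𝓝[>] 0, e ∈ Ioo 0 δ := Ioo_mem_nhdsGT h.δ_pos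
  rw [← integral_sphereDensity hα]
  refine tendsto_integral_filter_of_dominated_convergence
    (fun x => 5 / 4 * (1 / √(discrConst α)) * (3 / 4) ^ (α - 1 / 2) *
      (x ^ (α - 1 / 2) * (1 / √(x * (1 - x))))) ?_ ?_
    ((integrableOn_rpow_mul_one_div_sqrt hα).const_mul _) ?_
  · exact Eventually.of_forall fun e => (measurable_axialDensity _ _ _ _).aestronglyMeasurable
  · refine hpos.mono fun e he => ?_
    have hr := h.isRoots hα (by linarith) hσ he
    refine (ae_restrict_iff' measurableSet_Ioo).2 (Eventually.of_forall fun x hx => ?_)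
    refine (hr.abs_axialDensity_le (by linarith) hx).trans ?_
    have hx0 := hx.1
    have hx1 := sub_pos.2 hx.2
    have hy : 3 / 4 * x ≤ (1 - x) * u e + x * v e := by
      have a1 := hr.v_mem.1
      have a2 := mul_nonneg hx1.le hr.u_pos.le
      nlinarith
    have hy0 : 0 < (1 - x) * u e + x * v e := lt_of_lt_of_le (by positivity) hy
    rw [div_sqrt_mul _ _ hy0.le]
    have e1 : ((1 - x) * u e + x * v e) ^ α * (1 / √((1 - x) * u e + x * v e)) =
        ((1 - x) * u e + x * v e) ^ (α - 1 / 2) := by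
      rw [Real.sqrt_eq_rpow, one_div, ← Real.rpow_neg hy0.le, ← Real.rpow_add hy0]
      rfl
    have e2 : ((1 - x) * u e + x * v e) ^ (α - 1 / 2) ≤
        (3 / 4) ^ (α - 1 / 2) * x ^ (α - 1 / 2) := by
      rw [← Real.mul_rpow (by norm_num) hx0.le]
      exact Real.rpow_le_rpow_of_nonpos (by positivity) hy (by linarith)
    rw [e1, mul_assoc _ ((3 / 4 : ℝ) ^ (α - 1 / 2)), ← mul_assoc ((3 / 4 : ℝ) ^ (α - 1 / 2))]
    gcongr
  · refine (ae_restrict_iff' measurableSet_Ioo).2 (Eventually.of_forall fun x hx => ?_)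
    have hx0 := hx.1
    have hid : Tendsto (fun e : ℝ => e) (𝓝[>] 0) (𝓝 0) := tendsto_id.mono_left nhdsWithin_le_nhds
    have hu : Tendsto u (𝓝[>] 0) (𝓝 0) := by
      have := h.u_div.mul hid
      simp only [mul_zero] at this
      refine this.congr' (hpos.mono fun e he => ?_)
      have := he.1
      field_simp
    have hy : Tendsto (fun e => (1 - x) * u e + x * v e) (𝓝[>] 0) (𝓝 x) := by
      simpa using (hu.const_mul (1 - x)).add (h.v_lim.const_mul x)
    have hvu : Tendsto (fun e => v e - u e) (𝓝[>] 0) (𝓝 1) := by simpa using h.v_lim.sub hu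
    have hU : Tendsto (fun e => ((1 - x) * u e + x * v e) ^ (1 + α) + σ * e) (𝓝[>] 0)
        (𝓝 (x ^ (1 + α))) := by
      simpa using (hy.rpow_const (p := 1 + α) (Or.inl hx0.ne')).add (hid.const_mul σ)
    have hD : Tendsto (fun e => discr α (σ * e) ((1 - x) * u e + x * v e)) (𝓝[>] 0)
        (𝓝 (discr α 0 x)) := by
      simpa [discr] using (hy.pow 2).sub (hU.pow 2)
    have t := ((hvu.const_mul α).mul (hy.rpow_const (p := α - 1) (Or.inl hx0.ne'))).mul
      (hU.div hD.sqrt (Real.sqrt_pos.2 (discr_zero_pos hα hx)).ne')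
    rw [mul_one] at t
    exact t

/-! ### The catenoid constant -/

/-- The substitution `r ^ N = 1 + ξ` in the catenoid constant. -/
theorem catenoidConst_eq {N : ℕ} (hN : 2 ≤ N) :
    IntegrableOn (fun r : ℝ => 1 / √(r ^ (2 * (N + 1) - 2) - 1)) (Ioi 1) ∧
    catenoidConst (N + 1) = ∫ ξ in Ioi 0, catenoidDensity (1 / N) ξ := by
  have hN0 : (0 : ℝ) < N := by positivity
  have hα : 0 < 1 / (N : ℝ) := by positivity
  have hα2 : 1 / (N : ℝ) ≤ 1 / 2 :=
    one_div_le_one_div_of_le two_pos (by exact_mod_cast hN)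
  have himg : (fun ξ : ℝ => (1 + ξ) ^ (1 / (N : ℝ))) '' Ioi 0 = Ioi 1 := by
    ext r
    constructor
    · rintro ⟨ξ, hξ, rfl⟩
      rw [mem_Ioi] at hξ
      exact Real.one_lt_rpow (by linarith) hα
    · intro hr
      rw [mem_Ioi] at hr
      refine ⟨r ^ N - 1, sub_pos.2 (one_lt_pow₀ hr (by omega)), ?_⟩
      simp only [add_sub_cancel]
      rw [one_div, Real.pow_rpow_inv_natCast (by linarith) (by omega)]
  have hder : ∀ ξ ∈ Ioi (0 : ℝ), HasDerivWithinAt (fun ξ : ℝ => (1 + ξ) ^ (1 / (N : ℝ)))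
      (1 / (N : ℝ) * (1 + ξ) ^ (1 / (N : ℝ) - 1)) (Ioi 0) ξ := by
    intro ξ hξ
    rw [mem_Ioi] at hξ
    have := ((hasDerivAt_id ξ).const_add 1).rpow_const (p := 1 / (N : ℝ))
      (Or.inl (show 1 + ξ ≠ 0 by positivity))
    exact (this.congr_deriv (by simp)).hasDerivWithinAt
  have hinj : InjOn (fun ξ : ℝ => (1 + ξ) ^ (1 / (N : ℝ))) (Ioi 0) := by
    intro a ha b hb hab
    rw [mem_Ioi] at ha hb
    have := (Real.rpow_left_inj (by linarith) (by linarith) hα.ne').1 hab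
    linarith
  have hcongr : ∀ ξ ∈ Ioi (0 : ℝ), |1 / (N : ℝ) * (1 + ξ) ^ (1 / (N : ℝ) - 1)| •
      (1 / √(((1 + ξ) ^ (1 / (N : ℝ))) ^ (2 * (N + 1) - 2) - 1)) =
      catenoidDensity (1 / N) ξ := by
    intro ξ hξ
    rw [mem_Ioi] at hξ
    have h1 : 0 ≤ 1 + ξ := by linarith
    rw [abs_of_pos (by positivity), show 2 * (N + 1) - 2 = N * 2 by omega, pow_mul, one_div,
      Real.rpow_inv_natCast_pow h1 (by omega), smul_eq_mul, catenoidDensity,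
      show (1 + ξ) ^ 2 - 1 = ξ * (2 + ξ) by ring]
    ring
  rw [catenoidConst, ← himg, integrableOn_image_iff_integrableOn_abs_deriv_smul
    measurableSet_Ioi hder hinj, integral_image_eq_integral_abs_deriv_smul measurableSet_Ioi hder
    hinj]
  exact ⟨(integrableOn_catenoidDensity hα hα2).congr_fun (fun ξ hξ => (hcongr ξ hξ).symm)
    measurableSet_Ioi, setIntegral_congr_fun measurableSet_Ioi hcongr⟩

/-! ### The half-period as a function of the force parameter -/

/-- The substitution `r ^ N = (1 - x) u + x v`. -/
theorem IsRoots.integral_radius {N : ℕ} (hN : 1 ≤ N) {σ e u v : ℝ}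
    (h : IsRoots (1 / N) σ e u v) :
    ∫ r in Ioo (u ^ (1 / (N : ℝ))) (v ^ (1 / (N : ℝ))),
      (r ^ (N + 1) + σ * e) / √(radialPotential (N + 1) (σ * e) r) =
      axialIntegral (1 / N) (σ * e) u v := by
  have hu0 := h.u_pos
  have huv := h.u_lt_v
  have hα := h.α_pos
  have hypos : ∀ x ∈ Ioo (0 : ℝ) 1, 0 < (1 - x) * u + x * v := fun x hx =>
    hu0.trans_le (h.mem_Icc (Ioo_subset_Icc_self hx)).1
  have himg : (fun x : ℝ => ((1 - x) * u + x * v) ^ (1 / (N : ℝ))) '' Ioo 0 1 =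
      Ioo (u ^ (1 / (N : ℝ))) (v ^ (1 / (N : ℝ))) := by
    ext r
    constructor
    · rintro ⟨x, hx, rfl⟩
      have := hypos x hx
      exact ⟨Real.rpow_lt_rpow hu0.le (by nlinarith [hx.1, hx.2]) hα,
        Real.rpow_lt_rpow this.le (by nlinarith [hx.1, hx.2]) hα⟩
    · rintro ⟨hr1, hr2⟩
      have hr0 : 0 < r := lt_trans (by positivity) hr1
      have h1 : u < r ^ N := by
        have := pow_lt_pow_left₀ hr1 (by positivity) (show N ≠ 0 by omega)
        rwa [one_div, Real.rpow_inv_natCast_pow hu0.le (by omega)] at this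
      have h2 : r ^ N < v := by
        have := pow_lt_pow_left₀ hr2 hr0.le (show N ≠ 0 by omega)
        rwa [one_div, Real.rpow_inv_natCast_pow (hu0.trans huv).le (by omega)] at this
      have hd : 0 < v - u := sub_pos.2 huv
      refine ⟨(r ^ N - u) / (v - u), ⟨div_pos (by linarith) hd, ?_⟩, ?_⟩
      · rw [div_lt_one hd]; linarith
      · have : (1 - (r ^ N - u) / (v - u)) * u + (r ^ N - u) / (v - u) * v = r ^ N := by
          field_simp; ring
        simp only [this]
        rw [one_div, Real.pow_rpow_inv_natCast hr0.le (by omega)]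
  rw [← himg, integral_image_eq_integral_abs_deriv_smul (f' := fun x =>
    (v - u) * (1 / (N : ℝ)) * ((1 - x) * u + x * v) ^ (1 / (N : ℝ) - 1)) measurableSet_Ioo]
  · refine setIntegral_congr_fun measurableSet_Ioo fun x hx => ?_
    have hy := hypos x hx
    have hd : 0 < v - u := sub_pos.2 huv
    have e1 : (((1 - x) * u + x * v) ^ (1 / (N : ℝ))) ^ N = (1 - x) * u + x * v := by
      rw [one_div, Real.rpow_inv_natCast_pow hy.le (by omega)]
    have e2 : (((1 - x) * u + x * v) ^ (1 / (N : ℝ))) ^ (N + 1) =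
        ((1 - x) * u + x * v) ^ (1 + 1 / (N : ℝ)) := by
      rw [pow_succ, e1, Real.rpow_add hy, Real.rpow_one]
    simp only [axialDensity, discr, radialPotential, smul_eq_mul]
    rw [show 2 * (N + 1) - 2 = N * 2 by omega, pow_mul, e1, e2, abs_of_pos (by positivity)]
    ring
  · intro x hx
    have := ((((hasDerivAt_id x).const_sub 1).mul_const u).add
      ((hasDerivAt_id x).mul_const v)).rpow_const (p := 1 / (N : ℝ)) (Or.inl (hypos x hx).ne')
    exact (this.congr_deriv (by simp only [id, Pi.add_apply]; ring)).hasDerivWithinAt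
  · intro a ha b hb hab
    have := (Real.rpow_left_inj (hypos a ha).le (hypos b hb).le hα.ne').1 hab
    have h2 : (a - b) * (v - u) = 0 := by linear_combination this
    rcases mul_eq_zero.1 h2 with h3 | h3 <;> linarith

/-- For a force parameter with roots as above, the Delaunay profile exists and is unique, its
radius has a least period, and its half-period is the axial integral minus `1`. -/
theorem IsRoots.delaunay {N : ℕ} (hN : 1 ≤ N) {σ e u v : ℝ} (h : IsRoots (1 / N) σ e u v)
    (hu : u < (1 / 4) ^ (1 / (1 / (N : ℝ)))) :
    (∃! p : (ℝ → ℝ) × (ℝ → ℝ), IsDelaunayProfile (N + 1) (σ * e) p.1 p.2) ∧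
      IsLeast {T : ℝ | 0 < T ∧ Function.Periodic (delaunayRadius (N + 1) (σ * e)) T}
        (delaunayDomainPeriod (N + 1) (σ * e)) ∧
      delaunayHalfPeriod (N + 1) (σ * e) = axialIntegral (1 / N) (σ * e) u v - 1 := by
  have hn : 2 ≤ N + 1 := by omega
  have hR := h.isRadiusRange hN hu
  obtain ⟨r, k, L, hp, hL, hk⟩ := hR.exists_profile hn
  have huniq : ∀ p : (ℝ → ℝ) × (ℝ → ℝ), IsDelaunayProfile (N + 1) (σ * e) p.1 p.2 →
      p = (r, k) := fun p hp' => by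
    obtain ⟨h1, h2⟩ := hp'.unique hn hp hR
    exact Prod.ext h1 h2
  have heq : delaunayProfile (N + 1) (σ * e) = (r, k) :=
    huniq _ (Classical.epsilon_spec (p := fun p : (ℝ → ℝ) × (ℝ → ℝ) =>
      IsDelaunayProfile (N + 1) (σ * e) p.1 p.2) ⟨(r, k), hp⟩)
  have hrad : delaunayRadius (N + 1) (σ * e) = r := by rw [delaunayRadius, heq]
  have hax : delaunayAxis (N + 1) (σ * e) = k := by rw [delaunayAxis, heq]
  have hper : delaunayDomainPeriod (N + 1) (σ * e) = L := by
    rw [delaunayDomainPeriod, hrad]; exact hL.csInf_eq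
  refine ⟨⟨(r, k), hp, huniq⟩, ?_, ?_⟩
  · rw [hper, hrad]; exact hL
  · rw [delaunayHalfPeriod, hper, hax, hk, h.integral_radius hN]
    ring

/-- Behaviour of the half-period as the force parameter `σ e` tends to zero from one side. -/
theorem exists_halfPeriod_asymptotics {N : ℕ} (hN : 2 ≤ N) {σ : ℝ} (hσ : σ = 1 ∨ σ = -1) :
    ∃ δ > 0, (∀ e ∈ Ioo 0 δ,
      (∃! p : (ℝ → ℝ) × (ℝ → ℝ), IsDelaunayProfile (N + 1) (σ * e) p.1 p.2) ∧
      IsLeast {T : ℝ | 0 < T ∧ Function.Periodic (delaunayRadius (N + 1) (σ * e)) T}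
        (delaunayDomainPeriod (N + 1) (σ * e)) ∧
      DifferentiableAt ℝ (delaunayHalfPeriod (N + 1)) (σ * e)) ∧
    Tendsto (fun e : ℝ => e ^ (-(1 / (N : ℝ))) * delaunayHalfPeriod (N + 1) (σ * e))
      (𝓝[>] 0) (𝓝 (σ * catenoidConst (N + 1))) ∧
    Tendsto (fun e : ℝ => e ^ (1 - 1 / (N : ℝ)) * deriv (delaunayHalfPeriod (N + 1)) (σ * e))
      (𝓝[>] 0) (𝓝 (catenoidConst (N + 1) / N)) := by
  have hN0 : (0 : ℝ) < N := by positivity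
  have hα : 0 < 1 / (N : ℝ) := by positivity
  have hα2 : 1 / (N : ℝ) ≤ 1 / 2 :=
    one_div_le_one_div_of_le two_pos (by exact_mod_cast hN)
  have hσ2 : σ * σ = 1 := by rcases hσ with hs | hs <;> rw [hs] <;> norm_num
  obtain ⟨δ, K, u, v, u', v', h⟩ := exists_isRootPair hα σ
  have hdel := fun e (he : e ∈ Ioo 0 δ) =>
    (h.isRoots hα (by linarith) hσ he).delaunay (by omega) (h.u_upper e he)
  have hev : ∀ᶠ e : ℝ in 𝓝[>] 0, e ∈ Ioo 0 δ := Ioo_mem_nhdsGT h.δ_pos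
  set I' : ℝ → ℝ := fun e =>
    ∫ x in Ioo (0 : ℝ) 1, axialDensityDeriv (1 / N) σ e (u e) (v e) (u' e) (v' e) x with hI'
  have hd : ∀ e ∈ Ioo 0 δ, HasDerivAt (fun e => delaunayHalfPeriod (N + 1) (σ * e)) (I' e) e := by
    intro e he
    refine ((h.hasDerivAt_axialIntegral hα (by linarith) hσ he).2.sub_const 1).congr_of_eventuallyEq
      ?_
    filter_upwards [Ioo_mem_nhds he.1 he.2] with s hs using (hdel s hs).2.2
  have hdP : ∀ e ∈ Ioo 0 δ, HasDerivAt (delaunayHalfPeriod (N + 1)) (σ * I' e) (σ * e) := by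
    intro e he
    have h1 : HasDerivAt (fun τ : ℝ => σ * τ) σ (σ * e) := by
      simpa using (hasDerivAt_id (σ * e)).const_mul σ
    have h2 := hd e he
    rw [show e = σ * (σ * e) by rw [← mul_assoc, hσ2, one_mul]] at h2
    have h3 := h2.comp (σ * e) h1
    rw [← mul_assoc σ σ e, hσ2, one_mul, mul_comm (I' e)] at h3
    refine h3.congr_of_eventuallyEq (Eventually.of_forall fun τ => ?_)
    simp only [Function.comp]
    rw [← mul_assoc, hσ2, one_mul]
  have hlim := h.tendsto_integral_axialDensityDeriv hα hα2 hσ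
  rw [← (catenoidConst_eq hN).2] at hlim
  refine ⟨δ, h.δ_pos, fun e he => ⟨(hdel e he).1, (hdel e he).2.1,
    (hdP e he).differentiableAt⟩, ?_, ?_⟩
  · -- l'Hôpital's rule, the half-period tending to zero
    have hP0 : Tendsto (fun e => delaunayHalfPeriod (N + 1) (σ * e)) (𝓝[>] 0) (𝓝 0) := by
      have := (h.tendsto_axialIntegral hα hα2 hσ).sub_const 1
      rw [sub_self] at this
      exact this.congr' (hev.mono fun e he => ((hdel e he).2.2).symm)
    have hg0 : Tendsto (fun e : ℝ => e ^ (1 / (N : ℝ))) (𝓝[>] 0) (𝓝 0) := by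
      have := (Real.continuousAt_rpow_const 0 (1 / (N : ℝ)) (Or.inr hα.le)).tendsto
      rw [Real.zero_rpow hα.ne'] at this
      exact this.mono_left nhdsWithin_le_nhds
    have hdiv : Tendsto (fun e => I' e / (1 / (N : ℝ) * e ^ (1 / (N : ℝ) - 1))) (𝓝[>] 0)
        (𝓝 (σ * catenoidConst (N + 1))) := by
      have := hlim.const_mul (N : ℝ)
      rw [show (N : ℝ) * (σ * (1 / N * catenoidConst (N + 1))) = σ * catenoidConst (N + 1) by
        field_simp] at this
      refine this.congr' (hev.mono fun e he => ?_)
      have he0 := he.1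
      rw [show (1 : ℝ) - 1 / N = -(1 / N - 1) by ring, Real.rpow_neg he0.le]
      have : 0 < e ^ (1 / (N : ℝ) - 1) := by positivity
      field_simp
      rfl
    have := HasDerivAt.lhopital_zero_nhdsGT (hev.mono fun e he => hd e he)
      (hev.mono fun e he => Real.hasDerivAt_rpow_const (p := 1 / (N : ℝ)) (Or.inl he.1.ne'))
      (hev.mono fun e he => by have := he.1; positivity) hP0 hg0 hdiv
    refine this.congr' (hev.mono fun e he => ?_)
    dsimp only
    rw [Real.rpow_neg he.1.le, div_eq_inv_mul]
  · have := hlim.const_mul σ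
    rw [← mul_assoc, hσ2, one_mul, one_div_mul_eq_div] at this
    refine this.congr' (hev.mono fun e he => ?_)
    dsimp only
    rw [(hdP e he).deriv]
    ring

theorem mainTheorem3 (n : ℕ) (hn : 3 ≤ n) :
    (∀ᶠ τ : ℝ in 𝓝[≠] 0,
      (∃! p : (ℝ → ℝ) × (ℝ → ℝ), IsDelaunayProfile n τ p.1 p.2) ∧
      IsLeast {T : ℝ | 0 < T ∧ Function.Periodic (delaunayRadius n τ) T}
        (delaunayDomainPeriod n τ) ∧
      DifferentiableAt ℝ (delaunayHalfPeriod n) τ) ∧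
    IntegrableOn (fun r : ℝ => 1 / √(r ^ (2 * n - 2) - 1)) (Ioi 1) ∧
    Tendsto (fun τ : ℝ => |τ| ^ (1 / (1 - (n : ℝ))) * delaunayHalfPeriod n τ)
      (𝓝[>] 0) (𝓝 (catenoidConst n)) ∧
    Tendsto (fun τ : ℝ => |τ| ^ (1 / (1 - (n : ℝ))) * delaunayHalfPeriod n τ)
      (𝓝[<] 0) (𝓝 (-catenoidConst n)) ∧
    Tendsto (fun τ : ℝ => |τ| ^ (((n : ℝ) - 2) / ((n : ℝ) - 1)) *
        deriv (delaunayHalfPeriod n) τ)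
      (𝓝[≠] 0) (𝓝 (catenoidConst n / ((n : ℝ) - 1))) := by
  obtain ⟨N, rfl⟩ : ∃ N, n = N + 1 := ⟨n - 1, by omega⟩
  have hN : 2 ≤ N := by omega
  have hN0 : (0 : ℝ) < N := by positivity
  have e1 : 1 / (1 - ((N + 1 : ℕ) : ℝ)) = -(1 / (N : ℝ)) := by
    push_cast; rw [show (1 : ℝ) - (N + 1) = -N by ring, one_div, one_div, inv_neg]
  have e2 : (((N + 1 : ℕ) : ℝ) - 2) / (((N + 1 : ℕ) : ℝ) - 1) = 1 - 1 / (N : ℝ) := by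
    push_cast; rw [show (N : ℝ) + 1 - 1 = N by ring]; field_simp; ring
  have e3 : ((N + 1 : ℕ) : ℝ) - 1 = N := by push_cast; ring
  rw [e1, e2, e3]
  obtain ⟨δ, hδ, hp1, hp2, hp3⟩ := exists_halfPeriod_asymptotics hN (σ := 1) (Or.inl rfl)
  obtain ⟨δ', hδ', hm1, hm2, hm3⟩ := exists_halfPeriod_asymptotics hN (σ := -1) (Or.inr rfl)
  simp only [one_mul, neg_one_mul] at hp1 hp2 hp3 hm1 hm2 hm3
  have hneg : Tendsto (fun τ : ℝ => -τ) (𝓝[<] 0) (𝓝[>] 0) := by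
    simpa using tendsto_neg_nhdsLT (a := (0 : ℝ))
  have habsp : ∀ᶠ τ : ℝ in 𝓝[>] 0, |τ| = τ :=
    eventually_mem_nhdsWithin.mono fun τ hτ => abs_of_pos hτ
  have habsm : ∀ᶠ τ : ℝ in 𝓝[<] 0, |τ| = -τ :=
    eventually_mem_nhdsWithin.mono fun τ hτ => abs_of_neg hτ
  refine ⟨?_, (catenoidConst_eq hN).1, ?_, ?_, ?_⟩
  · rw [← nhdsLT_sup_nhdsGT, eventually_sup]
    constructor
    · filter_upwards [Ioo_mem_nhdsLT (show -δ' < 0 by linarith)] with τ hτ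
      simpa using hm1 (-τ) ⟨by linarith [hτ.2], by linarith [hτ.1]⟩
    · filter_upwards [Ioo_mem_nhdsGT hδ] with τ hτ using hp1 τ hτ
  · exact hp2.congr' (habsp.mono fun τ hτ => by dsimp only; rw [hτ])
  · exact (hm2.comp hneg).congr' (habsm.mono fun τ hτ => by
      simp only [Function.comp, neg_neg]; rw [hτ])
  · rw [← nhdsLT_sup_nhdsGT, tendsto_sup]
    constructor
    · exact (hm3.comp hneg).congr' (habsm.mono fun τ hτ => by
        simp only [Function.comp, neg_neg]; rw [hτ])
    · exact hp3.congr' (habsp.mono fun τ hτ => by dsimp only; rw [hτ])
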